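/- **Theorem 4.3.** Let $n\ge 3$, let $\Omega=\{1,\dots,n-1\}$, and let $S_n$ be the star graph with vertex set $\Omega^0=\{0,1,\dots,n-1\}$ and edges $\{0,i\}$, $1\le i\le n-1$. Partial transformations of $\Omega^0$ are written on the right and composed from left to right. Let $\mathrm{PswEnd}(S_n)$ (respectively $\mathrm{PsEnd}(S_n)$) be the monoid of all partial transformations $\alpha$ of $\Omega^0$ such that, for all $u,v\in\mathrm{dom}(\alpha)$, one has $\{u,v\}\in E(S_n)$ and $u\alpha\ne v\alpha$ (respectively $\{u,v\}\in E(S_n)$) if and only if $\{u\alpha,v\alpha\}\in E(S_n)$. Let $M_0$ be the monoid of all partial transformations $\alpha$ of $\Omega^0$ with $0\in\mathrm{dom}(\alpha)$, $0\alpha=0$ and $\Omega\alpha\subseteq\Omega$. Consider the following partial transformations of $\Omega^0$: $a_0$ exchanges $1$ and $2$ and fixes the other points; $b_0$ fixes $0$ and is the cycle $1\mapsto2\mapsto\cdots\mapsto n-1\mapsto1$ on $\Omega$; $e_0$ sends $2$ to $1$ and fixes the other points; $f_0$ and $d$ are the partial identities with domains $\Omega^0\setminus\{1\}$ and $\Omega$;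 $z$ sends $0$ to $1$ and every $i\in\Omega$ to $0$; $z_0$ is the constant full transformation with value $0$. For a set $R$ of relations on an alphabet $X$, let $\sim_R$ be the congruence on the free monoid $X^*$ generated by $R$. The presentation $\langle X\mid R\rangle$ defines a monoid $M$ on given elements of $M$ indexed by $X$ if there is an isomorphism $X^*/{\sim_R}\to M$ sending the class of each letter to the corresponding element. A set $W\subseteq X^*$ is a set of canonical forms for a finite monoid $M$ with respect to $R$ if each word in $X^*$ is $\sim_R$-equivalent to a word in $W$ and $|W|\le|M|$. Let $R_0$ be any set of relations defining $M_0$ on the generators $a_0,b_0,e_0,f_0$. Let $R_{\mathrm s}$ be $R_0$ together with $$d^2=d,\quad a_0d=da_0,\quad b_0d=db_0,\quad e_0d=de_0,\quad f_0d=df_0,$$ $$a_0z=z,\quad b_0z=z,\quad e_0z=z,\quad dz=zf_0,\quad zd=(f_0b_0)^{n-1}z,\quad z^2=(e_0b_0)^{n-3}e_0,\quad d(f_0b_0)^{n-1}z=d(f_0b_0)^{n-1},$$ and let $R_{\mathrm{sw}}$ be $R_{\mathrm s}$ together with $$b_0z_0=z_0,\quad zz_0=z_0,\quad z_0a_0=z_0,\quad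 z_0b_0=z_0,\quad z_0e_0=z_0,\quad z_0f_0=z_0,\quad dz_0=dz,\quad z_0d=d(f_0b_0)^{n-1}.$$ Then the presentation $\langle a_0,b_0,e_0,f_0,d,z,z_0\mid R_{\mathrm{sw}}\rangle$ defines the monoid $\mathrm{PswEnd}(S_n)$ on the transformations $a_0,b_0,e_0,f_0,d,z,z_0$, and $|\mathrm{PswEnd}(S_n)|=2n^{n-1}+n2^n-n-1$. Moreover, let $W_0\subseteq\{a_0,b_0,e_0,f_0\}^*$ be any set of canonical forms for $M_0$ with respect to $R_0$ that contains the empty word and the word $(f_0b_0)^{n-1}$. For $\emptyset\ne A\subseteq\Omega$, let $u_A$ be the word of $W_0$ representing the transformation with domain $A\cup\{0\}$ that sends $0$ to $0$ and each element of $A$ to $1$. For $\emptyset\ne A\subsetneq\Omega$, let $w_A$ be any word on $\{a_0,b_0,f_0\}$ representing the partial identity with domain $A\cup\{0\}$, and let $w_\Omega$ be the empty word. Put $$W_1=dW_0,\quad W_2=\{u_Azb_0^{j-1}\mid\emptyset\ne A\subseteq\Omega,\ 1\le j\le n-1\},\quad W_3=\{du_Az\mid\emptyset\ne A\subseteq\Omega\},$$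 $$W_4=\{(f_0b_0)^{n-1}zb_0^{j-1}\mid1\le j\le n-1\},\quad W_{\mathrm s}=W_0\cup W_1\cup W_2\cup W_3\cup W_4,$$ $$W_5=\{w_Az_0\mid\emptyset\ne A\subseteq\Omega\},\quad W_6=\{w_Az_0zb_0^k\mid\emptyset\ne A\subseteq\Omega,\ 0\le k\le n-2\}.$$ Then $W_{\mathrm s}\cup W_5\cup W_6$ is a set of canonical forms for $\mathrm{PswEnd}(S_n)$ with respect to $R_{\mathrm{sw}}$, and it has exactly $2n^{n-1}+n2^n-n-1$ elements. The same holds for $V\cup W_5\cup W_6$, where $V$ is any set of canonical forms for $\mathrm{PsEnd}(S_n)$ with respect to $R_{\mathrm s}$ that contains the empty word. -/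

import Mathlib

namespace StarGraphMonoid

/-! ### Partial transformations -/

/-- A partial transformation `α` of `Ω`: `α x = none` means that `x` is not in the domain,
and `α x = some y` means that `x` is in the domain and is sent to `y`. -/
def PT (Ω : Type*) : Type _ := Ω → Option Ω

/-- Composition from left to right: `α * β` is first `α`, then `β`. -/
instance instMonoidPT (Ω : Type*) : Monoid (PT Ω) where
  mul α β := fun x => (α x).bind β
  one := fun x => some x
  mul_assoc α β γ := funext fun x => Option.bind_assoc (α x) β γ
  one_mul _ := rfl
  mul_one α := funext fun x => Option.bind_fun_some (α x)

theorem PT.mul_eq_some {Ω : Type*} {α β : PT Ω} {x y : Ω} :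
    (α * β) x = some y ↔ ∃ t, α x = some t ∧ β t = some y :=
  Option.bind_eq_some_iff

theorem PT.one_eq_some {Ω : Type*} {x y : Ω} : (1 : PT Ω) x = some y ↔ x = y :=
  Option.some_inj

/-- The monoid of partial strong endomorphisms of a simple graph. -/
def PsEnd {V : Type*} (G : SimpleGraph V) : Submonoid (PT V) where
  carrier := {α | ∀ u v u' v', α u = some u' → α v = some v' → (G.Adj u v ↔ G.Adj u' v')}
  one_mem' := by
    intro u v u' v' hu hv
    rw [PT.one_eq_some] at hu hv
    subst hu hv
    rfl
  mul_mem' := by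
    intro α β hα hβ u v u' v' hu hv
    obtain ⟨s, hs, hs'⟩ := PT.mul_eq_some.1 hu
    obtain ⟨t, ht, ht'⟩ := PT.mul_eq_some.1 hv
    exact (hα u v s t hs ht).trans (hβ s t u' v' hs' ht')

/-- The monoid of partial strong weak endomorphisms of a simple graph. -/
def PswEnd {V : Type*} (G : SimpleGraph V) : Submonoid (PT V) where
  carrier := {α | ∀ u v u' v', α u = some u' → α v = some v' →
    ((G.Adj u v ∧ u' ≠ v') ↔ G.Adj u' v')}
  one_mem' := by
    intro u v u' v' hu hv
    rw [PT.one_eq_some] at hu hv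
    subst hu hv
    exact ⟨fun h => h.1, fun h => ⟨h, h.ne⟩⟩
  mul_mem' := by
    intro α β hα hβ u v u' v' hu hv
    obtain ⟨s, hs, hs'⟩ := PT.mul_eq_some.1 hu
    obtain ⟨t, ht, ht'⟩ := PT.mul_eq_some.1 hv
    have h1 := hα u v s t hs ht
    have h2 := hβ s t u' v' hs' ht'
    constructor
    · rintro ⟨h, hne⟩
      refine h2.1 ⟨h1.1 ⟨h, ?_⟩, hne⟩
      rintro rfl
      rw [hs'] at ht'
      exact hne (Option.some_inj.1 ht')
    · intro h
      exact ⟨(h1.2 (h2.2 h).1).1, (h2.2 h).2⟩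

/-! ### The star graph and the transformations of its vertices -/

section Star

variable (n : ℕ) [NeZero n]

/-- The star graph on the `n` vertices `0, 1, …, n - 1`, with edges `{0, i}` for `1 ≤ i ≤ n - 1`. -/
def starGraph : SimpleGraph (Fin n) where
  Adj u v := u ≠ v ∧ (u = 0 ∨ v = 0)
  symm := ⟨fun _ _ h => ⟨h.1.symm, h.2.symm⟩⟩
  loopless := ⟨fun _ h => h.1 rfl⟩

/-- The copy, inside the partial transformations of `{0, 1, …, n - 1}`, of the monoid of partial
transformations of `{1, …, n - 1}` obtained by extending each of them by `0 ↦ 0`. -/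
def PTzeta : Submonoid (PT (Fin n)) where
  carrier := {α | α 0 = some 0 ∧ ∀ x y, x ≠ 0 → α x = some y → y ≠ 0}
  one_mem' := by
    refine ⟨rfl, fun x y hx h => ?_⟩
    rw [PT.one_eq_some] at h
    exact h ▸ hx
  mul_mem' := by
    intro α β hα hβ
    refine ⟨PT.mul_eq_some.2 ⟨0, hα.1, hβ.1⟩, fun x y hx h => ?_⟩
    obtain ⟨t, ht, ht'⟩ := PT.mul_eq_some.1 h
    exact hβ.2 t y (hα.2 x t hx ht) ht'

/-- `0 ↦ 0`, `1 ↦ 2`, `2 ↦ 1`, and `i ↦ i` for `i ≥ 3`. -/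
def ta : PT (Fin n) := fun i => some (if i = 1 then 2 else if i = 2 then 1 else i)

/-- `0 ↦ 0`, `i ↦ i + 1` for `1 ≤ i ≤ n - 2`, and `n - 1 ↦ 1`. -/
def tb : PT (Fin n) := fun i =>
  some (if i = 0 then 0 else if (i : ℕ) + 1 = n then 1 else i + 1)

/-- `2 ↦ 1`, and `i ↦ i` for `i ≠ 2`. -/
def te : PT (Fin n) := fun i => some (if i = 2 then 1 else i)

/-- The partial identity with domain `{0, 2, 3, …, n - 1}`. -/
def tf : PT (Fin n) := fun i => if i = 1 then none else some i

/-- The partial identity with domain `{1, …, n - 1}`. -/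
def td : PT (Fin n) := fun i => if i = 0 then none else some i

/-- `0 ↦ 1`, and `i ↦ 0` for `i ≥ 1`. -/
def tz : PT (Fin n) := fun i => some (if i = 0 then 1 else 0)

/-- The constant full transformation with value `0`. -/
def tz0 : PT (Fin n) := fun _ => some 0

/-- `0 ↦ 0`, and `i ↦ 1` for `i ∈ A`, with domain `{0} ∪ A`, where `0 ∉ A`. -/
def collapse (A : Finset (Fin n)) : PT (Fin n) := fun i =>
  if i = 0 then some 0 else if i ∈ A then some 1 else none

/-- The partial identity with domain `{0} ∪ A`. -/
def partialId (A : Finset (Fin n)) : PT (Fin n) := fun i =>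
  if i = 0 ∨ i ∈ A then some i else none

end Star

/-! ### Presentations -/

/-- The monoid presentation `⟨X ∣ R⟩` defines the monoid `M` (a submonoid of `P`) on the
generators `g x`: there is an isomorphism of `X* / ∼_R` onto `M` that sends the class of each
letter `x` to `g x`. In particular each `g x` lies in `M`, and they generate `M`. -/
def Defines {X P : Type*} [Monoid P] (R : FreeMonoid X → FreeMonoid X → Prop)
    (M : Submonoid P) (g : X → P) : Prop :=
  ∃ φ : PresentedMonoid R ≃* M, ∀ x, (φ (PresentedMonoid.of R x) : P) = g x

/-- `W` is a set of canonical forms for the finite monoid `M` with respect to the relations `R`: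
each word is `∼_R`-equivalent to a word in `W`, and `|W| ≤ |M|`. -/
def IsCanonicalForms {X P : Type*} [Monoid P] (R : FreeMonoid X → FreeMonoid X → Prop)
    (M : Submonoid P) (W : Set (FreeMonoid X)) : Prop :=
  (∀ w, ∃ w' ∈ W, conGen R w w') ∧ W.encard ≤ (M : Set P).encard

/-- The alphabet `{a₀, b₀, e₀, f₀}`. -/
inductive L0 : Type
  | a | b | e | f

/-- The alphabet `{a₀, b₀, e₀, f₀, d, z}`. -/
inductive Ls : Type
  | base (x : L0) | d | z

/-- The alphabet `{a₀, b₀, e₀, f₀, d, z, z₀}`. -/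
inductive Lsw : Type
  | base (x : Ls) | z0

/-- Words on `{a₀, b₀, e₀, f₀}` as words on `{a₀, b₀, e₀, f₀, d, z}`. -/
def inclS : FreeMonoid L0 →* FreeMonoid Ls := FreeMonoid.map Ls.base

/-- Words on `{a₀, b₀, e₀, f₀, d, z}` as words on `{a₀, b₀, e₀, f₀, d, z, z₀}`. -/
def inclSw : FreeMonoid Ls →* FreeMonoid Lsw := FreeMonoid.map Lsw.base

namespace L0

/-- The one-letter words on `{a₀, b₀, e₀, f₀}`. -/
abbrev wa : FreeMonoid L0 := FreeMonoid.of .a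
abbrev wb : FreeMonoid L0 := FreeMonoid.of .b
abbrev we : FreeMonoid L0 := FreeMonoid.of .e
abbrev wf : FreeMonoid L0 := FreeMonoid.of .f

/-- The transformations denoted by the letters. -/
def gen (n : ℕ) [NeZero n] : L0 → PT (Fin n)
  | a => ta n
  | b => tb n
  | e => te n
  | f => tf n

/-- The transformation represented by a word on `{a₀, b₀, e₀, f₀}`. -/
def eval (n : ℕ) [NeZero n] : FreeMonoid L0 →* PT (Fin n) := FreeMonoid.lift (gen n)

end L0

namespace Ls

/-- The one-letter words on `{a₀, b₀, e₀, f₀, d, z}`. -/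
abbrev wa : FreeMonoid Ls := FreeMonoid.of (.base .a)
abbrev wb : FreeMonoid Ls := FreeMonoid.of (.base .b)
abbrev we : FreeMonoid Ls := FreeMonoid.of (.base .e)
abbrev wf : FreeMonoid Ls := FreeMonoid.of (.base .f)
abbrev wd : FreeMonoid Ls := FreeMonoid.of .d
abbrev wz : FreeMonoid Ls := FreeMonoid.of .z

/-- The relations `R_s`: the relations `R₀` (on the letters `a₀, b₀, e₀, f₀`), the five further
relations of `R_d`, and seven relations that involve `z`. -/
inductive Rel (n : ℕ) (R₀ : FreeMonoid L0 → FreeMonoid L0 → Prop) :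
    FreeMonoid Ls → FreeMonoid Ls → Prop
  | base (u v : FreeMonoid L0) (h : R₀ u v) : Rel n R₀ (inclS u) (inclS v)
  | d_sq : Rel n R₀ (wd ^ 2) wd
  | a_d : Rel n R₀ (wa * wd) (wd * wa)
  | b_d : Rel n R₀ (wb * wd) (wd * wb)
  | e_d : Rel n R₀ (we * wd) (wd * we)
  | f_d : Rel n R₀ (wf * wd) (wd * wf)
  | a_z : Rel n R₀ (wa * wz) wz
  | b_z : Rel n R₀ (wb * wz) wz
  | e_z : Rel n R₀ (we * wz) wz
  | d_z : Rel n R₀ (wd * wz) (wz * wf)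
  | z_d : Rel n R₀ (wz * wd) ((wf * wb) ^ (n - 1) * wz)
  | z_sq : Rel n R₀ (wz ^ 2) ((we * wb) ^ (n - 3) * we)
  | d_fb_z : Rel n R₀ (wd * (wf * wb) ^ (n - 1) * wz) (wd * (wf * wb) ^ (n - 1))

end Ls

namespace Lsw

/-- The one-letter words on `{a₀, b₀, e₀, f₀, d, z, z₀}`. -/
abbrev wa : FreeMonoid Lsw := FreeMonoid.of (.base (.base .a))
abbrev wb : FreeMonoid Lsw := FreeMonoid.of (.base (.base .b))
abbrev we : FreeMonoid Lsw := FreeMonoid.of (.base (.base .e))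
abbrev wf : FreeMonoid Lsw := FreeMonoid.of (.base (.base .f))
abbrev wd : FreeMonoid Lsw := FreeMonoid.of (.base .d)
abbrev wz : FreeMonoid Lsw := FreeMonoid.of (.base .z)
abbrev wz0 : FreeMonoid Lsw := FreeMonoid.of .z0

/-- The transformations denoted by the letters. -/
def gen (n : ℕ) [NeZero n] : Lsw → PT (Fin n)
  | base (.base x) => L0.gen n x
  | base .d => td n
  | base .z => tz n
  | z0 => tz0 n

/-- The relations `R_sw`: the relations `R_s` and eight relations that involve `z₀`. -/
inductive Rel (n : ℕ) (R₀ : FreeMonoid L0 → FreeMonoid L0 → Prop) :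
    FreeMonoid Lsw → FreeMonoid Lsw → Prop
  | base (u v : FreeMonoid Ls) (h : Ls.Rel n R₀ u v) : Rel n R₀ (inclSw u) (inclSw v)
  | b_z0 : Rel n R₀ (wb * wz0) wz0
  | z_z0 : Rel n R₀ (wz * wz0) wz0
  | z0_a : Rel n R₀ (wz0 * wa) wz0
  | z0_b : Rel n R₀ (wz0 * wb) wz0
  | z0_e : Rel n R₀ (wz0 * we) wz0
  | z0_f : Rel n R₀ (wz0 * wf) wz0
  | d_z0 : Rel n R₀ (wd * wz0) (wd * wz)
  | z0_d : Rel n R₀ (wz0 * wd) (wd * (wf * wb) ^ (n - 1))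

end Lsw

/-! ### Canonical forms -/

section Canonical

variable (n : ℕ) [NeZero n]

/-- `W₀` is an admissible set of canonical forms for `PTzeta n` on `a₀, b₀, e₀, f₀`: it contains
the empty word and the word `(f₀ b₀) ^ (n - 1)`. -/
def IsBaseForms (R₀ : FreeMonoid L0 → FreeMonoid L0 → Prop) (W₀ : Set (FreeMonoid L0)) : Prop :=
  IsCanonicalForms R₀ (PTzeta n) W₀ ∧ 1 ∈ W₀ ∧ (L0.wf * L0.wb) ^ (n - 1) ∈ W₀

/-- The words `d w` with `w ∈ W₀`. -/
def W1 (W₀ : Set (FreeMonoid L0)) : Set (FreeMonoid Ls) :=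
  {w | ∃ u ∈ W₀, w = Ls.wd * inclS u}

/-- The words `w z b₀ ^ (j - 1)`, where `1 ≤ j ≤ n - 1` and `w ∈ W₀` represents `collapse n A` for
some non-empty subset `A` of `{1, …, n - 1}`. -/
def W2 (W₀ : Set (FreeMonoid L0)) : Set (FreeMonoid Ls) :=
  {w | ∃ A : Finset (Fin n), A.Nonempty ∧ 0 ∉ A ∧ ∃ u ∈ W₀, L0.eval n u = collapse n A ∧
    ∃ j : ℕ, 1 ≤ j ∧ j ≤ n - 1 ∧ w = inclS u * Ls.wz * Ls.wb ^ (j - 1)}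

/-- The words `d w z`, where `w ∈ W₀` represents `collapse n A` for some non-empty subset `A` of
`{1, …, n - 1}`. -/
def W3 (W₀ : Set (FreeMonoid L0)) : Set (FreeMonoid Ls) :=
  {w | ∃ A : Finset (Fin n), A.Nonempty ∧ 0 ∉ A ∧ ∃ u ∈ W₀, L0.eval n u = collapse n A ∧
    w = Ls.wd * inclS u * Ls.wz}

/-- The words `(f₀ b₀) ^ (n - 1) z b₀ ^ (j - 1)`, where `1 ≤ j ≤ n - 1`. -/
def W4 : Set (FreeMonoid Ls) :=
  {w | ∃ j : ℕ, 1 ≤ j ∧ j ≤ n - 1 ∧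
    w = (Ls.wf * Ls.wb) ^ (n - 1) * Ls.wz * Ls.wb ^ (j - 1)}

/-- The set of words `W_s = W₀ ∪ W₁ ∪ W₂ ∪ W₃ ∪ W₄`. -/
def Ws (W₀ : Set (FreeMonoid L0)) : Set (FreeMonoid Ls) :=
  inclS '' W₀ ∪ W1 W₀ ∪ W2 n W₀ ∪ W3 n W₀ ∪ W4 n

/-- `ω A`, for each non-empty proper subset `A` of `{1, …, n - 1}`, is a word on `{a₀, b₀, f₀}`
representing the partial identity on `{0} ∪ A`; and `ω {1, …, n - 1}` is the empty word. -/
def IsIdWords (ω : Finset (Fin n) → FreeMonoid L0) : Prop :=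
  (∀ A : Finset (Fin n), A.Nonempty → A ⊂ Finset.univ.erase 0 →
    ω A ∈ Submonoid.closure {L0.wa, L0.wb, L0.wf} ∧ L0.eval n (ω A) = partialId n A) ∧
  ω (Finset.univ.erase 0) = 1

/-- The words `ω A z₀`, where `A` is a non-empty subset of `{1, …, n - 1}`. -/
def W5 (ω : Finset (Fin n) → FreeMonoid L0) : Set (FreeMonoid Lsw) :=
  {w | ∃ A : Finset (Fin n), A.Nonempty ∧ 0 ∉ A ∧ w = inclSw (inclS (ω A)) * Lsw.wz0}

/-- The words `ω A z₀ z b₀ ^ k`, where `A` is a non-empty subset of `{1, …, n - 1}` and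
`0 ≤ k ≤ n - 2`. -/
def W6 (ω : Finset (Fin n) → FreeMonoid L0) : Set (FreeMonoid Lsw) :=
  {w | ∃ A : Finset (Fin n), A.Nonempty ∧ 0 ∉ A ∧ ∃ k : ℕ, k ≤ n - 2 ∧
    w = inclSw (inclS (ω A)) * Lsw.wz0 * Lsw.wz * Lsw.wb ^ k}

/-- The set of words `V ∪ W₅ ∪ W₆`, for a set `V` of words on `{a₀, b₀, e₀, f₀, d, z}`. -/
def Wsw (V : Set (FreeMonoid Ls)) (ω : Finset (Fin n) → FreeMonoid L0) : Set (FreeMonoid Lsw) :=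
  inclSw '' V ∪ W5 n ω ∪ W6 n ω

end Canonical

end StarGraphMonoid

/-! Everything is reduced to a list of normal forms, indexed by the finite type `IndexSw n`, that
makes sense in any monoid. Let `ι` map `PTzeta n` into a monoid `P`, and let `d`, `z`, `z₀` in `P`
satisfy the relations of `IsStarTriple`. Write c_A for the image of `collapse n A`, and c when A
consists of all leaves. The normal forms are ι m, d ι m, c_A z b₀^(j-1), d c_A z, and, with the
partial identity on A and 0 in place of c_A, the products of it with z₀ and with z₀ z b₀^(j-1).

Upper bound. Left multiplication by ι m, d, z or z₀ sends normal forms to normal forms (`ι_mul_mem`,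
`d_mul_mem`, `z_mul_mem`, `z₀_mul_mem`). Two facts drive this: α c_A is again a collapse for every α
in `PTzeta n`, and c α depends only on the value of α at 1. As the presented monoid satisfies
`IsStarTriple`, every word equals a normal form there (`nfSw_surjective`).

Lower bound. Among the transformations themselves, the normal forms are pairwise distinct
(`transSw_injective`) and are exactly the members of `PswEnd (starGraph n)` (`range_transSw`).

The map from `IndexSw n` to transformations factors through the presented monoid. Its first factor
is surjective and the composite is injective, so evaluation of words is injective on the presented
monoid, with image `PswEnd (starGraph n)`. This proves the presentation, and the order is the
cardinality of `IndexSw n`. The sets of words in the theorem cover all normal forms and are no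
larger than the index type. -/

namespace StarGraphMonoid

/-! ### Computations with the generating transformations, collapses and partial identities. -/

section Transformations

variable {n : ℕ} [NeZero n]

theorem PT.mul_apply {Ω : Type*} (α β : PT Ω) (x : Ω) :
    (α * β) x = (α x).bind fun y => β y := rfl

theorem PT.one_apply {Ω : Type*} (x : Ω) : (1 : PT Ω) x = some x := rfl

theorem val_one_eq (hn : 3 ≤ n) : ((1 : Fin n) : ℕ) = 1 := by
  rw [Fin.val_one', Nat.mod_eq_of_lt (by omega)]

theorem val_two_eq (hn : 3 ≤ n) : ((2 : Fin n) : ℕ) = 2 := by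
  have : (2 : Fin n) = Fin.ofNat n 2 := rfl
  rw [this, Fin.val_ofNat, Nat.mod_eq_of_lt (by omega)]

theorem eq_zero_iff_val (i : Fin n) : i = 0 ↔ (i : ℕ) = 0 := by
  rw [Fin.ext_iff, Fin.val_zero]

theorem eq_one_iff_val (hn : 3 ≤ n) (i : Fin n) : i = 1 ↔ (i : ℕ) = 1 := by
  rw [Fin.ext_iff, val_one_eq hn]

theorem eq_two_iff_val (hn : 3 ≤ n) (i : Fin n) : i = 2 ↔ (i : ℕ) = 2 := by
  rw [Fin.ext_iff, val_two_eq hn]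

theorem one_ne_zero_fin (hn : 3 ≤ n) : (1 : Fin n) ≠ 0 := by
  rw [Ne, eq_zero_iff_val, val_one_eq hn]; omega

theorem two_ne_zero_fin (hn : 3 ≤ n) : (2 : Fin n) ≠ 0 := by
  rw [Ne, eq_zero_iff_val, val_two_eq hn]; omega

theorem one_ne_two_fin (hn : 3 ≤ n) : (1 : Fin n) ≠ 2 := by
  rw [Ne, eq_two_iff_val hn, val_one_eq hn]; omega

theorem tb_zero : tb n 0 = some 0 := by simp [tb]

theorem tb_last (i : Fin n) (h0 : i ≠ 0) (h : (i : ℕ) + 1 = n) : tb n i = some 1 := by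
  simp [tb, h0, h]

theorem tb_succ (i : Fin n) (h0 : i ≠ 0) (h : (i : ℕ) + 1 < n) :
    tb n i = some ⟨i + 1, h⟩ := by
  have h1 : (i + 1 : Fin n) = ⟨i + 1, h⟩ := by
    apply Fin.ext
    rw [Fin.val_add, Fin.val_one', Nat.add_mod_mod, Nat.mod_eq_of_lt h]
  simp [tb, h0, h.ne, h1]

theorem ta_mem_PTzeta (hn : 3 ≤ n) : ta n ∈ PTzeta n := by
  have h1 := one_ne_zero_fin hn
  have h2 := two_ne_zero_fin hn
  refine ⟨by simp [ta, h1.symm, h2.symm], fun x y hx h => ?_⟩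
  simp only [ta, Option.some_inj] at h
  split_ifs at h <;> subst h <;> assumption

theorem tb_mem_PTzeta (hn : 3 ≤ n) : tb n ∈ PTzeta n := by
  refine ⟨tb_zero, fun x y hx h => ?_⟩
  rcases (Nat.succ_le_of_lt x.2).lt_or_eq with h' | h'
  · rw [tb_succ x hx h', Option.some_inj] at h
    rw [← h, Ne, eq_zero_iff_val]
    simp
  · rw [tb_last x hx h', Option.some_inj] at h
    exact h ▸ one_ne_zero_fin hn

theorem te_mem_PTzeta (hn : 3 ≤ n) : te n ∈ PTzeta n := by
  have h1 := one_ne_zero_fin hn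
  have h2 := two_ne_zero_fin hn
  refine ⟨by simp [te, h2.symm], fun x y hx h => ?_⟩
  simp only [te, Option.some_inj] at h
  split_ifs at h <;> subst h <;> assumption

theorem tf_mem_PTzeta (hn : 3 ≤ n) : tf n ∈ PTzeta n := by
  have h1 := one_ne_zero_fin hn
  refine ⟨by simp [tf, h1.symm], fun x y hx h => ?_⟩
  simp only [tf] at h
  split_ifs at h
  rw [Option.some_inj] at h
  exact h ▸ hx

theorem collapse_mem_PTzeta (hn : 3 ≤ n) (A : Finset (Fin n)) : collapse n A ∈ PTzeta n := by
  refine ⟨by simp [collapse], fun x y hx h => ?_⟩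
  simp only [collapse, hx, if_false] at h
  split_ifs at h
  rw [Option.some_inj] at h
  exact h ▸ one_ne_zero_fin hn

theorem partialId_mem_PTzeta (A : Finset (Fin n)) : partialId n A ∈ PTzeta n := by
  refine ⟨by simp [partialId], fun x y hx h => ?_⟩
  simp only [partialId] at h
  split_ifs at h
  rw [Option.some_inj] at h
  exact h ▸ hx

theorem PTzeta_pow_zero {α : PT (Fin n)} (h : α ∈ PTzeta n) (k : ℕ) : (α ^ k) 0 = some 0 :=
  ((PTzeta n).pow_mem h k).1

/-- The powers of `b₀` move `1` around the cycle. -/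
theorem tb_pow_one (hn : 3 ≤ n) (k : ℕ) (hk : k + 1 < n) :
    (tb n ^ k) 1 = some ⟨k + 1, hk⟩ := by
  induction k with
  | zero =>
    rw [pow_zero, PT.one_apply, Option.some_inj]
    exact Fin.ext (val_one_eq hn)
  | succ k ih =>
    rw [pow_succ, PT.mul_apply, ih (by omega), Option.bind_some, tb_succ]
    · rw [Ne, eq_zero_iff_val]; simp

theorem tb_pow_pred_one (hn : 3 ≤ n) (j : Fin n) (hj : j ≠ 0) :
    (tb n ^ ((j : ℕ) - 1)) 1 = some j := by
  have h := j.2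
  rw [Ne, eq_zero_iff_val] at hj
  rw [tb_pow_one hn _ (by omega), Option.some_inj]
  apply Fin.ext
  simp only
  omega

/-- The `if` expression counts the rounds of `f₀ b₀` that a leaf survives before it lies at 1, where
`f₀` deletes it. Each round lowers the count by one. It is at most n - 2, so n - 1 rounds delete
every leaf. -/
theorem tf_mul_tb_pow (hn : 3 ≤ n) (k : ℕ) (x y : Fin n) (hx : x ≠ 0)
    (h : ((tf n * tb n) ^ k) x = some y) :
    y ≠ 0 ∧ (if (y : ℕ) = 1 then 0 else n - y) + k = if (x : ℕ) = 1 then 0 else n - x := by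
  induction k generalizing y with
  | zero =>
    rw [pow_zero, PT.one_eq_some] at h
    subst h
    exact ⟨hx, rfl⟩
  | succ k ih =>
    rw [pow_succ, PT.mul_eq_some] at h
    obtain ⟨t, ht, hty⟩ := h
    obtain ⟨ht0, hk⟩ := ih t ht
    rw [PT.mul_eq_some] at hty
    obtain ⟨s, hs, hsy⟩ := hty
    simp only [tf] at hs
    split_ifs at hs with h1
    rw [Option.some_inj] at hs
    subst hs
    refine ⟨(tb_mem_PTzeta hn).2 _ _ ht0 hsy, ?_⟩
    rw [← hk]
    rw [eq_one_iff_val hn] at h1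
    rw [if_neg h1]
    rcases (Nat.succ_le_of_lt t.2).lt_or_eq with h' | h'
    · rw [tb_succ t ht0 h', Option.some_inj] at hsy
      subst hsy
      rw [Ne, eq_zero_iff_val] at ht0
      simp only
      rw [if_neg (by omega)]
      omega
    · rw [tb_last t ht0 h', Option.some_inj] at hsy
      subst hsy
      rw [val_one_eq hn, if_pos rfl]
      omega

theorem tf_mul_tb_pow_pred (hn : 3 ≤ n) : (tf n * tb n) ^ (n - 1) = collapse n ∅ := by
  funext x
  by_cases hx : x = 0
  · subst hx
    rw [PTzeta_pow_zero ((PTzeta n).mul_mem (tf_mem_PTzeta hn) (tb_mem_PTzeta hn))]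
    simp [collapse]
  · have h : ((tf n * tb n) ^ (n - 1)) x = none := by
      rw [Option.eq_none_iff_forall_ne_some]
      intro y hy
      have h := (tf_mul_tb_pow hn _ x y hx hy).2
      rw [eq_zero_iff_val] at hx
      split_ifs at h <;> omega
    rw [h]
    simp [collapse, hx]

/-- The point 1 is fixed by `b₀ e₀`, since `b₀` moves it to 2 and `e₀` brings it back. A leaf from 3
on climbs one step per round until it wraps from n - 1 to 1 and stays there. For k = n - 3 all of
them have wrapped. -/
theorem te_mul_tb_pow_mul_te (hn : 3 ≤ n) (k : ℕ) (x : Fin n) (hx : x ≠ 0) :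
    ((te n * tb n) ^ k * te n) x =
      some (if h : 3 ≤ (x : ℕ) ∧ x + k < n then ⟨x + k, h.2⟩ else 1) := by
  induction k with
  | zero =>
    rw [pow_zero, one_mul, te, Option.some_inj]
    rw [Ne, eq_zero_iff_val] at hx
    have := x.2
    apply Fin.ext
    simp only [eq_two_iff_val hn]
    split_ifs <;> simp only [val_one_eq hn] <;> omega
  | succ k ih =>
    rw [pow_succ, mul_assoc, mul_assoc, ← mul_assoc, PT.mul_apply, ih, Option.bind_some,
      PT.mul_apply]
    by_cases h : 3 ≤ (x : ℕ) ∧ x + k < n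
    · rw [dif_pos h]
      by_cases h' : (x : ℕ) + k + 1 < n
      · rw [tb_succ _ (by rw [Ne, eq_zero_iff_val]; simp only; omega) h', Option.bind_some, te,
          dif_pos ⟨h.1, h'⟩, if_neg]
        · rfl
        · rw [eq_two_iff_val hn]; simp only; omega
      · rw [tb_last _ (by rw [Ne, eq_zero_iff_val]; simp only; omega) (by simp only; omega),
          Option.bind_some, te, dif_neg (by omega), if_neg (one_ne_two_fin hn)]
    · have h12 : (⟨((1 : Fin n) : ℕ) + 1, by rw [val_one_eq hn]; omega⟩ : Fin n) = 2 :=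
        Fin.ext (by rw [val_two_eq hn]; simp only [val_one_eq hn])
      rw [dif_neg h, tb_succ 1 (one_ne_zero_fin hn) (by rw [val_one_eq hn]; omega),
        Option.bind_some, te, dif_neg (by omega), h12, if_pos rfl]

theorem te_mul_tb_pow_mul_te_eq_collapse (hn : 3 ≤ n) :
    (te n * tb n) ^ (n - 3) * te n = collapse n (Finset.univ.erase 0) := by
  funext x
  by_cases hx : x = 0
  · subst hx
    have h := (PTzeta n).mul_mem ((PTzeta n).pow_mem
      ((PTzeta n).mul_mem (te_mem_PTzeta hn) (tb_mem_PTzeta hn)) (n - 3)) (te_mem_PTzeta hn)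
    rw [h.1]
    simp [collapse]
  · rw [te_mul_tb_pow_mul_te hn _ x hx, dif_neg (by omega)]
    simp [collapse, hx]

/-- The non-zero points that `α` sends into `A`. -/
def preim (α : PT (Fin n)) (A : Finset (Fin n)) : Finset (Fin n) :=
  {x | x ≠ 0 ∧ ∃ y ∈ A, α x = some y}

theorem zero_notMem_preim (α : PT (Fin n)) (A : Finset (Fin n)) : 0 ∉ preim α A := by
  simp [preim]

theorem mul_collapse {α : PT (Fin n)} (h : α ∈ PTzeta n) (A : Finset (Fin n)) :
    α * collapse n A = collapse n (preim α A) := by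
  funext x
  rw [PT.mul_apply]
  by_cases hx : x = 0
  · subst hx
    rw [h.1]
    simp [collapse]
  · rcases hy : α x with _ | y
    · simp [collapse, hx, preim, hy]
    · have := h.2 x y hx hy
      simp [collapse, hx, preim, hy, this]

theorem partialId_mul_collapse (A : Finset (Fin n)) :
    partialId n A * collapse n (Finset.univ.erase 0) = collapse n A := by
  funext x
  rw [PT.mul_apply]
  by_cases hx : x = 0
  · subst hx
    simp [collapse, partialId]
  · by_cases hxA : x ∈ A <;> simp [collapse, partialId, hx, hxA]

theorem collapse_mul_of_none {α : PT (Fin n)} (h : α ∈ PTzeta n) (h1 : α 1 = none) :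
    collapse n (Finset.univ.erase 0) * α = collapse n ∅ := by
  funext x
  rw [PT.mul_apply]
  by_cases hx : x = 0
  · subst hx
    simp [collapse, h.1]
  · simp [collapse, hx, h1]

theorem collapse_mul_of_eq {α β : PT (Fin n)} (hα : α ∈ PTzeta n) (hβ : β ∈ PTzeta n)
    (h1 : α 1 = β 1) (A : Finset (Fin n)) :
    collapse n A * α = collapse n A * β := by
  funext x
  rw [PT.mul_apply, PT.mul_apply]
  by_cases hx : x = 0
  · subst hx
    simp [collapse, hα.1, hβ.1]
  · by_cases hxA : x ∈ A <;> simp [collapse, hx, h1, hxA]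

theorem collapse_empty_mul {α : PT (Fin n)} (h : α ∈ PTzeta n) :
    collapse n ∅ * α = collapse n ∅ := by
  funext x
  rw [PT.mul_apply]
  by_cases hx : x = 0
  · subst hx
    simp [collapse, h.1]
  · simp [collapse, hx]

theorem partialId_univ_erase : partialId n (Finset.univ.erase 0) = 1 := by
  funext x
  by_cases hx : x = 0 <;> simp [partialId, hx, PT.one_apply]

theorem partialId_empty : partialId n ∅ = collapse n ∅ := by
  funext x
  by_cases hx : x = 0 <;> simp [partialId, collapse, hx]

end Transformations

/-! ### Normal forms in an abstract monoid, and their closure under left multiplication. -/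

section NormalForms

variable {n : ℕ} [NeZero n]

/-- `collapse n A` as an element of `PTzeta n`. -/
def collapseZ (hn : 3 ≤ n) (A : Finset (Fin n)) : PTzeta n :=
  ⟨collapse n A, collapse_mem_PTzeta hn A⟩

/-- `partialId n A` as an element of `PTzeta n`. -/
def partialIdZ (A : Finset (Fin n)) : PTzeta n := ⟨partialId n A, partialId_mem_PTzeta A⟩

/-- The cycle `b₀` as an element of `PTzeta n`. -/
def cycleZ (hn : 3 ≤ n) : PTzeta n := ⟨tb n, tb_mem_PTzeta hn⟩

/-- The relations that tie two elements `d` and `z` of a monoid to the image of `PTzeta n`. -/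
structure IsStarPair (hn : 3 ≤ n) {P : Type*} [Monoid P] (ι : PTzeta n →* P) (d z : P) :
    Prop where
  d_mul_d : d * d = d
  comm : ∀ m, ι m * d = d * ι m
  collapse_mul_z : ι (collapseZ hn (Finset.univ.erase 0)) * z = z
  d_mul_z : d * z = z * ι ⟨tf n, tf_mem_PTzeta hn⟩
  z_mul_d : z * d = ι (collapseZ hn ∅) * z
  z_mul_z : z * z = ι (collapseZ hn (Finset.univ.erase 0))
  d_empty_z : d * ι (collapseZ hn ∅) * z = d * ι (collapseZ hn ∅)

/-- The relations that tie a further element `z₀` to an `IsStarPair`. -/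
structure IsStarTriple (hn : 3 ≤ n) {P : Type*} [Monoid P] (ι : PTzeta n →* P) (d z z₀ : P) :
    Prop extends IsStarPair hn ι d z where
  collapse_mul_z₀ : ι (collapseZ hn (Finset.univ.erase 0)) * z₀ = z₀
  z_mul_z₀ : z * z₀ = z₀
  z₀_mul : ∀ m, z₀ * ι m = z₀
  d_mul_z₀ : d * z₀ = d * z
  z₀_mul_d : z₀ * d = d * ι (collapseZ hn ∅)

variable (n) in
/-- The non-empty subsets of `{1, …, n - 1}`. -/
abbrev LeafSet : Type := {A : Finset (Fin n) // A.Nonempty ∧ 0 ∉ A}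

variable (n) in
/-- Indices of the normal forms of the elements of `PsEnd (starGraph n)`. -/
abbrev IndexS : Type := (PTzeta n ⊕ PTzeta n) ⊕ ((LeafSet n × Fin n) ⊕ {j : Fin n // j ≠ 0})

variable (n) in
/-- Indices of the normal forms of the elements of `PswEnd (starGraph n)`. -/
abbrev IndexSw : Type := IndexS n ⊕ (LeafSet n × Fin n)

/-- The normal forms built from `d` and `z`. -/
def nfS (hn : 3 ≤ n) {P : Type*} [Monoid P] (ι : PTzeta n →* P) (d z : P) : IndexS n → P :=
  Sum.elim (Sum.elim ι fun m => d * ι m)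
    (Sum.elim
      (fun p => if p.2 = 0 then d * ι (collapseZ hn p.1) * z
        else ι (collapseZ hn p.1) * z * ι (cycleZ hn) ^ ((p.2 : ℕ) - 1))
      fun j => ι (collapseZ hn ∅) * z * ι (cycleZ hn) ^ ((j : ℕ) - 1))

/-- The normal forms built from `z` and `z₀`. -/
def nfConst (hn : 3 ≤ n) {P : Type*} [Monoid P] (ι : PTzeta n →* P) (z z₀ : P) :
    LeafSet n × Fin n → P := fun p =>
  if p.2 = 0 then ι (partialIdZ p.1) * z₀
  else ι (partialIdZ p.1) * z₀ * z * ι (cycleZ hn) ^ ((p.2 : ℕ) - 1)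

/-- The normal forms built from `d`, `z` and `z₀`. -/
def nfSw (hn : 3 ≤ n) {P : Type*} [Monoid P] (ι : PTzeta n →* P) (d z z₀ : P) :
    IndexSw n → P :=
  Sum.elim (nfS hn ι d z) (nfConst hn ι z z₀)

section Maps

variable {P Q : Type*} [Monoid P] [Monoid Q] (hn : 3 ≤ n) (ι : PTzeta n →* P) (d z z₀ : P)
  (f : P →* Q)

theorem map_nfS (i : IndexS n) :
    f (nfS hn ι d z i) = nfS hn (f.comp ι) (f d) (f z) i := by
  rcases i with (m | m) | (⟨A, k⟩ | j)
  · rfl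
  · simp [nfS]
  · simp only [nfS, Sum.elim_inr, Sum.elim_inl]
    split_ifs <;> simp
  · simp [nfS]

theorem map_nfSw (i : IndexSw n) :
    f (nfSw hn ι d z z₀ i) = nfSw hn (f.comp ι) (f d) (f z) (f z₀) i := by
  rcases i with i | ⟨A, k⟩
  · exact map_nfS hn ι d z f i
  · simp only [nfSw, nfConst, Sum.elim_inr]
    split_ifs <;> simp

end Maps

theorem coe_collapseZ (hn : 3 ≤ n) (A : Finset (Fin n)) :
    (collapseZ hn A : PT (Fin n)) = collapse n A := rfl

theorem mul_collapseZ (hn : 3 ≤ n) (m : PTzeta n) (A : Finset (Fin n)) :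
    m * collapseZ hn A = collapseZ hn (preim m A) := Subtype.ext (mul_collapse m.2 A)

theorem partialIdZ_mul_collapseZ (hn : 3 ≤ n) (A : Finset (Fin n)) :
    partialIdZ A * collapseZ hn (Finset.univ.erase 0) = collapseZ hn A :=
  Subtype.ext (partialId_mul_collapse A)

theorem collapseZ_mul_of_none (hn : 3 ≤ n) (m : PTzeta n) (h : (m : PT (Fin n)) 1 = none) :
    collapseZ hn (Finset.univ.erase 0) * m = collapseZ hn ∅ :=
  Subtype.ext (collapse_mul_of_none m.2 h)

theorem collapseZ_mul_of_some (hn : 3 ≤ n) (m : PTzeta n) (j : Fin n)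
    (h : (m : PT (Fin n)) 1 = some j) (A : Finset (Fin n)) :
    collapseZ hn A * m = collapseZ hn A * cycleZ hn ^ ((j : ℕ) - 1) := by
  have hj : j ≠ 0 := m.2.2 1 j (one_ne_zero_fin hn) h
  refine Subtype.ext (collapse_mul_of_eq m.2 (cycleZ hn ^ ((j : ℕ) - 1)).2 ?_ A)
  rw [h, SubmonoidClass.coe_pow, cycleZ, tb_pow_pred_one hn j hj]

theorem collapseZ_empty_mul (hn : 3 ≤ n) (m : PTzeta n) :
    collapseZ hn ∅ * m = collapseZ hn ∅ := Subtype.ext (collapse_empty_mul m.2)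

theorem partialIdZ_univ_erase : partialIdZ (n := n) (Finset.univ.erase 0) = 1 :=
  Subtype.ext partialId_univ_erase

theorem partialIdZ_empty (hn : 3 ≤ n) : partialIdZ (n := n) ∅ = collapseZ hn ∅ :=
  Subtype.ext partialId_empty

namespace IsStarPair

variable {hn : 3 ≤ n} {P : Type*} [Monoid P] {ι : PTzeta n →* P} {d z : P}

/-- Since z² = c, both z c and c z equal z³, and c z = z. -/
theorem z_mul_collapse (H : IsStarPair hn ι d z) :
    z * ι (collapseZ hn (Finset.univ.erase 0)) = z := by
  rw [← H.z_mul_z, ← mul_assoc, H.z_mul_z, H.collapse_mul_z]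

/-- Because z = z c, the product z m depends only on the value of m at 1. When that is undefined, m
may be replaced by `f₀`, and z f₀ = d z. -/
theorem z_mul_of_none (H : IsStarPair hn ι d z) (m : PTzeta n)
    (h : (m : PT (Fin n)) 1 = none) : z * ι m = d * z := by
  have key : ∀ m : PTzeta n, (m : PT (Fin n)) 1 = none → z * ι m = z * ι (collapseZ hn ∅) := by
    intro m h
    conv_lhs => rw [← H.z_mul_collapse]
    rw [mul_assoc, ← map_mul, collapseZ_mul_of_none hn m h]
  rw [H.d_mul_z, key m h, key ⟨tf n, tf_mem_PTzeta hn⟩ (by simp [tf])]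

theorem z_mul_of_some (H : IsStarPair hn ι d z) (m : PTzeta n) (j : Fin n)
    (h : (m : PT (Fin n)) 1 = some j) : z * ι m = z * ι (cycleZ hn) ^ ((j : ℕ) - 1) := by
  rw [← H.z_mul_collapse, mul_assoc, mul_assoc, ← map_pow, ← map_mul, ← map_mul,
    collapseZ_mul_of_some hn m j h]

/-- Here d z = z c_∅, and c_∅ absorbs every element of `PTzeta n` on its right. -/
theorem d_mul_z_mul (H : IsStarPair hn ι d z) (m : PTzeta n) : d * z * ι m = d * z := by
  have h : z * ι (collapseZ hn ∅) = d * z :=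
    H.z_mul_of_none _ (by simp [coe_collapseZ, collapse, one_ne_zero_fin hn])
  rw [← h, mul_assoc, ← map_mul, collapseZ_empty_mul]

theorem mem_range_one (m : PTzeta n) : ι m ∈ Set.range (nfS hn ι d z) := ⟨.inl (.inl m), rfl⟩

theorem mem_range_d (m : PTzeta n) : d * ι m ∈ Set.range (nfS hn ι d z) :=
  ⟨.inl (.inr m), rfl⟩

/-- For empty A the product is the normal form indexed by j alone. -/
theorem mem_range_z (A : Finset (Fin n)) (hA : 0 ∉ A) (j : Fin n) (hj : j ≠ 0) :
    ι (collapseZ hn A) * z * ι (cycleZ hn) ^ ((j : ℕ) - 1) ∈ Set.range (nfS hn ι d z) := by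
  rcases A.eq_empty_or_nonempty with rfl | hne
  · exact ⟨.inr (.inr ⟨j, hj⟩), rfl⟩
  · exact ⟨.inr (.inl (⟨A, hne, hA⟩, j)), by simp [nfS, hj]⟩

/-- For empty A the product is the empty transformation, already listed as d c_∅; the relation
`d_empty_z` identifies the two. -/
theorem mem_range_d_z (H : IsStarPair hn ι d z) (A : Finset (Fin n)) (hA : 0 ∉ A) :
    d * ι (collapseZ hn A) * z ∈ Set.range (nfS hn ι d z) := by
  rcases A.eq_empty_or_nonempty with rfl | hne
  · rw [H.d_empty_z]
    exact mem_range_d _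
  · exact ⟨.inr (.inl (⟨A, hne, hA⟩, 0)), by simp [nfS]⟩

theorem induction_range {p : P → Prop} (h1 : ∀ m, p (ι m)) (h2 : ∀ m, p (d * ι m))
    (h3 : ∀ A : Finset (Fin n), 0 ∉ A → ∀ j : Fin n, j ≠ 0 →
      p (ι (collapseZ hn A) * z * ι (cycleZ hn) ^ ((j : ℕ) - 1)))
    (h4 : ∀ A : Finset (Fin n), 0 ∉ A → p (d * ι (collapseZ hn A) * z)) :
    ∀ x ∈ Set.range (nfS hn ι d z), p x := by
  rintro _ ⟨(m | m) | (⟨A, j⟩ | j), rfl⟩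
  · exact h1 m
  · exact h2 m
  · simp only [nfS, Sum.elim_inr, Sum.elim_inl]
    split_ifs with hj
    · exact h4 _ A.2.2
    · exact h3 _ A.2.2 j hj
  · exact h3 _ (by simp) j j.2

theorem ι_mul_mem (H : IsStarPair hn ι d z) (m : PTzeta n) :
    ∀ x ∈ Set.range (nfS hn ι d z), ι m * x ∈ Set.range (nfS hn ι d z) := by
  refine induction_range ?_ ?_ ?_ ?_
  · intro m'
    rw [← map_mul]
    exact mem_range_one _
  · intro m'
    rw [← mul_assoc, H.comm, mul_assoc, ← map_mul]
    exact mem_range_d _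
  · intro A hA j hj
    rw [← mul_assoc, ← mul_assoc, ← map_mul, mul_collapseZ]
    exact mem_range_z _ (zero_notMem_preim _ _) j hj
  · intro A hA
    rw [← mul_assoc, ← mul_assoc, H.comm, mul_assoc d, ← map_mul, mul_collapseZ]
    exact H.mem_range_d_z _ (zero_notMem_preim _ _)

theorem d_mul_mem (H : IsStarPair hn ι d z) :
    ∀ x ∈ Set.range (nfS hn ι d z), d * x ∈ Set.range (nfS hn ι d z) := by
  refine induction_range ?_ ?_ ?_ ?_
  · exact mem_range_d
  · intro m
    rw [← mul_assoc, H.d_mul_d]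
    exact mem_range_d _
  · intro A hA j hj
    rw [← mul_assoc, ← mul_assoc, ← H.comm, mul_assoc _ d, mul_assoc, ← map_pow, H.d_mul_z_mul,
      ← mul_assoc, H.comm]
    exact H.mem_range_d_z A hA
  · intro A hA
    rw [← mul_assoc, ← mul_assoc, H.d_mul_d]
    exact H.mem_range_d_z A hA

theorem z_mul_ι_mem (H : IsStarPair hn ι d z) (m : PTzeta n) :
    z * ι m ∈ Set.range (nfS hn ι d z) := by
  rcases h : (m : PT (Fin n)) 1 with _ | j
  · have := H.mem_range_d_z (Finset.univ.erase 0) (by simp)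
    rwa [mul_assoc, H.collapse_mul_z, ← H.z_mul_of_none m h] at this
  · have := mem_range_z (hn := hn) (ι := ι) (d := d) (z := z) (Finset.univ.erase 0) (by simp) j (m.2.2 1 j (one_ne_zero_fin hn) h)
    rwa [H.collapse_mul_z, ← H.z_mul_of_some m j h] at this

/-- For a collapse c_A the product z c_A is z or d z, according to whether 1 lies in A. A second
factor z then turns z² into c, leaving no `z` to the right of the collapse. -/
theorem z_mul_mem (H : IsStarPair hn ι d z) :
    ∀ x ∈ Set.range (nfS hn ι d z), z * x ∈ Set.range (nfS hn ι d z) := by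
  refine induction_range ?_ ?_ ?_ ?_
  · exact H.z_mul_ι_mem
  · intro m
    rw [← mul_assoc, H.z_mul_d, mul_assoc]
    exact H.ι_mul_mem _ _ (H.z_mul_ι_mem m)
  · intro A hA j hj
    rw [← mul_assoc, ← mul_assoc, ← map_pow]
    rcases h : (collapseZ hn A : PT (Fin n)) 1 with _ | k
    · rw [H.z_mul_of_none _ h, mul_assoc d, H.z_mul_z, mul_assoc, ← map_mul]
      exact mem_range_d _
    -- A collapse sends leaves only to 1, so the power of the cycle that appears is the zeroth.
    · have hk : k = 1 := by
        simp only [coe_collapseZ, collapse, one_ne_zero_fin hn, if_false] at h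
        split_ifs at h
        exact (Option.some_inj.1 h).symm
      rw [H.z_mul_of_some _ k h, hk, val_one_eq hn, Nat.sub_self, pow_zero, mul_one, H.z_mul_z,
        ← map_mul]
      exact mem_range_one _
  · intro A hA
    rw [← mul_assoc, ← mul_assoc, H.z_mul_d, mul_assoc, mul_assoc]
    refine H.ι_mul_mem _ _ ?_
    rcases h : (collapseZ hn A : PT (Fin n)) 1 with _ | k
    · rw [← mul_assoc, H.z_mul_of_none _ h, mul_assoc d, H.z_mul_z]
      exact mem_range_d _
    · have hk : k = 1 := by
        simp only [coe_collapseZ, collapse, one_ne_zero_fin hn, if_false] at h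
        split_ifs at h
        exact (Option.some_inj.1 h).symm
      rw [← mul_assoc, H.z_mul_of_some _ k h, hk, val_one_eq hn, Nat.sub_self, pow_zero, mul_one,
        H.z_mul_z]
      exact mem_range_one _

end IsStarPair

/-! ### Closure once `z₀` is added. -/

namespace IsStarTriple

variable {hn : 3 ≤ n} {P : Type*} [Monoid P] {ι : PTzeta n →* P} {d z z₀ : P}

/-- Multiply d z₀ = d z by z on the left and use z d = c_∅ z: one side becomes c_∅ z₀, the other c_∅
c = c_∅. -/
theorem empty_mul_z₀ (H : IsStarTriple hn ι d z z₀) :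
    ι (collapseZ hn ∅) * z₀ = ι (collapseZ hn ∅) := by
  have h : z * d * z₀ = z * d * z := by rw [mul_assoc, H.d_mul_z₀, mul_assoc]
  rwa [H.z_mul_d, mul_assoc, H.z_mul_z₀, mul_assoc, H.z_mul_z, ← map_mul,
    collapseZ_empty_mul] at h

theorem z₀_mul_z₀ (H : IsStarTriple hn ι d z z₀) : z₀ * z₀ = z₀ := by
  conv_lhs => enter [1]; rw [← H.z₀_mul (collapseZ hn ∅)]
  rw [mul_assoc, H.empty_mul_z₀, H.z₀_mul]

theorem mem_range_inl {x : P} (hx : x ∈ Set.range (nfS hn ι d z)) :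
    x ∈ Set.range (nfSw hn ι d z z₀) := by
  obtain ⟨i, rfl⟩ := hx
  exact ⟨.inl i, rfl⟩

theorem mem_range_z₀ (H : IsStarTriple hn ι d z z₀) (A : Finset (Fin n)) (hA : 0 ∉ A) :
    ι (partialIdZ A) * z₀ ∈ Set.range (nfSw hn ι d z z₀) := by
  rcases A.eq_empty_or_nonempty with rfl | hne
  · rw [partialIdZ_empty hn, H.empty_mul_z₀]
    exact mem_range_inl (IsStarPair.mem_range_one _)
  · exact ⟨.inr (⟨A, hne, hA⟩, 0), by simp [nfSw, nfConst]⟩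

theorem mem_range_z₀_z (H : IsStarTriple hn ι d z z₀) (A : Finset (Fin n)) (hA : 0 ∉ A)
    (j : Fin n) (hj : j ≠ 0) :
    ι (partialIdZ A) * z₀ * z * ι (cycleZ hn) ^ ((j : ℕ) - 1) ∈
      Set.range (nfSw hn ι d z z₀) := by
  rcases A.eq_empty_or_nonempty with rfl | hne
  · rw [partialIdZ_empty hn, H.empty_mul_z₀]
    exact mem_range_inl (IsStarPair.mem_range_z _ (by simp) j hj)
  · exact ⟨.inr (⟨A, hne, hA⟩, j), by simp [nfSw, nfConst, hj]⟩

theorem induction_range {p : P → Prop} (h1 : ∀ x ∈ Set.range (nfS hn ι d z), p x)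
    (h2 : ∀ A : Finset (Fin n), 0 ∉ A → p (ι (partialIdZ A) * z₀))
    (h3 : ∀ A : Finset (Fin n), 0 ∉ A → ∀ j : Fin n, j ≠ 0 →
      p (ι (partialIdZ A) * z₀ * z * ι (cycleZ hn) ^ ((j : ℕ) - 1))) :
    ∀ x ∈ Set.range (nfSw hn ι d z z₀), p x := by
  rintro _ ⟨i | ⟨A, j⟩, rfl⟩
  · exact h1 _ ⟨i, rfl⟩
  · simp only [nfSw, nfConst, Sum.elim_inr]
    split_ifs with hj
    · exact h2 _ A.2.2
    · exact h3 _ A.2.2 j hj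

/-- As c z₀ = z₀, a partial identity in front of z₀ can be exchanged for the collapse with the same
domain, and collapses obey the preimage rule. -/
theorem ι_mul_partialId_mul_z₀ (H : IsStarTriple hn ι d z z₀) (m : PTzeta n)
    (A : Finset (Fin n)) :
    ι m * (ι (partialIdZ A) * z₀) = ι (partialIdZ (preim m A)) * z₀ := by
  have h (B : Finset (Fin n)) : ι (partialIdZ B) * z₀ = ι (collapseZ hn B) * z₀ := by
    conv_lhs => rw [← H.collapse_mul_z₀]
    rw [← mul_assoc, ← map_mul, partialIdZ_mul_collapseZ]
  rw [h, h, ← mul_assoc, ← map_mul, mul_collapseZ]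

theorem ι_mul_mem (H : IsStarTriple hn ι d z z₀) (m : PTzeta n) :
    ∀ x ∈ Set.range (nfSw hn ι d z z₀), ι m * x ∈ Set.range (nfSw hn ι d z z₀) := by
  refine induction_range ?_ ?_ ?_
  · exact fun x hx => mem_range_inl (H.toIsStarPair.ι_mul_mem m x hx)
  · intro A hA
    rw [H.ι_mul_partialId_mul_z₀]
    exact H.mem_range_z₀ _ (zero_notMem_preim _ _)
  · intro A hA j hj
    rw [← mul_assoc, ← mul_assoc, H.ι_mul_partialId_mul_z₀]
    exact H.mem_range_z₀_z _ (zero_notMem_preim _ _) j hj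

/-- A factor d turns z₀ into z, which leads back to the normal forms without z₀. -/
theorem d_mul_partialId_mul_z₀ (H : IsStarTriple hn ι d z z₀) (A : Finset (Fin n)) :
    d * (ι (partialIdZ A) * z₀) = ι (partialIdZ A) * (d * z) := by
  rw [← mul_assoc, ← H.comm, mul_assoc, H.d_mul_z₀]

theorem d_mul_mem (H : IsStarTriple hn ι d z z₀) :
    ∀ x ∈ Set.range (nfSw hn ι d z z₀), d * x ∈ Set.range (nfSw hn ι d z z₀) := by
  have hz : ∀ m, z * ι m ∈ Set.range (nfS hn ι d z) := H.toIsStarPair.z_mul_ι_mem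
  refine induction_range ?_ ?_ ?_
  · exact fun x hx => mem_range_inl (H.toIsStarPair.d_mul_mem x hx)
  · intro A hA
    rw [H.d_mul_partialId_mul_z₀]
    refine mem_range_inl (H.toIsStarPair.ι_mul_mem _ _ (H.toIsStarPair.d_mul_mem _ ?_))
    simpa using hz 1
  · intro A hA j hj
    rw [← mul_assoc, ← mul_assoc, H.d_mul_partialId_mul_z₀, mul_assoc, mul_assoc, mul_assoc,
      ← map_pow]
    exact mem_range_inl (H.toIsStarPair.ι_mul_mem _ _ (H.toIsStarPair.d_mul_mem _
      (H.toIsStarPair.z_mul_mem _ (hz _))))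

/-- The partial identity acts after z through its value at 1 only. If 1 is missing, d z z₀ remains,
and inserting c_∅ after d z lets c_∅ swallow z₀. -/
theorem z_mul_partialId_mul_z₀ (H : IsStarTriple hn ι d z z₀) (A : Finset (Fin n)) :
    z * (ι (partialIdZ A) * z₀) = z₀ ∨ z * (ι (partialIdZ A) * z₀) = d * z := by
  by_cases h1 : (1 : Fin n) ∈ A
  · left
    rw [← mul_assoc, H.z_mul_of_some (partialIdZ A) 1 (by simp [partialIdZ, partialId, h1]),
      val_one_eq hn, Nat.sub_self, pow_zero, mul_one, H.z_mul_z₀]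
  · right
    rw [← mul_assoc, H.z_mul_of_none (partialIdZ A)
      (by simp [partialIdZ, partialId, h1, one_ne_zero_fin hn]), ← H.d_mul_z_mul (collapseZ hn ∅),
      mul_assoc, H.empty_mul_z₀]

theorem z_mul_mem (H : IsStarTriple hn ι d z z₀) :
    ∀ x ∈ Set.range (nfSw hn ι d z z₀), z * x ∈ Set.range (nfSw hn ι d z z₀) := by
  have hz : ∀ m, z * ι m ∈ Set.range (nfS hn ι d z) := H.toIsStarPair.z_mul_ι_mem
  refine induction_range ?_ ?_ ?_
  · exact fun x hx => mem_range_inl (H.toIsStarPair.z_mul_mem x hx)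
  · intro A hA
    rcases H.z_mul_partialId_mul_z₀ A with h | h <;> rw [h]
    · simpa [partialIdZ_univ_erase] using H.mem_range_z₀ (Finset.univ.erase 0) (by simp)
    · refine mem_range_inl (H.toIsStarPair.d_mul_mem _ ?_)
      simpa using hz 1
  · intro A hA j hj
    rw [← mul_assoc, ← mul_assoc]
    rcases H.z_mul_partialId_mul_z₀ A with h | h <;> rw [h]
    · simpa [partialIdZ_univ_erase] using H.mem_range_z₀_z (Finset.univ.erase 0) (by simp) j hj
    · rw [mul_assoc, mul_assoc, ← map_pow]
      exact mem_range_inl (H.toIsStarPair.d_mul_mem _ (H.toIsStarPair.z_mul_mem _ (hz _)))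

theorem z₀_mul_mem (H : IsStarTriple hn ι d z z₀) :
    ∀ x ∈ Set.range (nfSw hn ι d z z₀), z₀ * x ∈ Set.range (nfSw hn ι d z z₀) := by
  have h0 : z₀ ∈ Set.range (nfSw hn ι d z z₀) := by
    simpa [partialIdZ_univ_erase] using H.mem_range_z₀ (Finset.univ.erase 0) (by simp)
  have h0z (j : Fin n) (hj : j ≠ 0) :
      z₀ * z * ι (cycleZ hn) ^ ((j : ℕ) - 1) ∈ Set.range (nfSw hn ι d z z₀) := by
    simpa [partialIdZ_univ_erase] using H.mem_range_z₀_z (Finset.univ.erase 0) (by simp) j hj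
  refine induction_range (IsStarPair.induction_range ?_ ?_ ?_ ?_) ?_ ?_
  · intro m
    rwa [H.z₀_mul]
  · intro m
    rw [← mul_assoc, H.z₀_mul_d, mul_assoc, ← map_mul]
    exact mem_range_inl (IsStarPair.mem_range_d _)
  · intro A hA j hj
    rw [← mul_assoc, ← mul_assoc, H.z₀_mul]
    exact h0z j hj
  · intro A hA
    rw [← mul_assoc, ← mul_assoc, H.z₀_mul_d, mul_assoc d, ← map_mul, collapseZ_empty_mul]
    exact mem_range_inl (H.mem_range_d_z _ (by simp))
  · intro A hA
    rwa [← mul_assoc, H.z₀_mul, H.z₀_mul_z₀]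
  · intro A hA j hj
    rw [← mul_assoc, ← mul_assoc, ← mul_assoc, H.z₀_mul, H.z₀_mul_z₀]
    exact h0z j hj

end IsStarTriple

end NormalForms

/-! ### The concrete transformations: distinctness, classification and counting. -/

section Enumeration

variable {n : ℕ} [NeZero n]

instance instFinitePT (Ω : Type*) [Finite Ω] : Finite (PT Ω) :=
  inferInstanceAs (Finite (Ω → Option Ω))

theorem PT.ext_of_ne_zero {α β : PT (Fin n)} (h0 : α 0 = β 0) (h : ∀ x, x ≠ 0 → α x = β x) :
    α = β := by
  funext x
  by_cases hx : x = 0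
  · rw [hx, h0]
  · exact h x hx

variable (hn : 3 ≤ n)

/-- The transformations enumerated by `IndexS n`. -/
abbrev transS : IndexS n → PT (Fin n) := nfS hn (PTzeta n).subtype (td n) (tz n)

/-- The transformations enumerated by `LeafSet n × Fin n`: the constant ones with `0` and a further
point in the domain. -/
abbrev transConst : LeafSet n × Fin n → PT (Fin n) :=
  nfConst hn (PTzeta n).subtype (tz n) (tz0 n)

/-- The transformations enumerated by `IndexSw n`. -/
abbrev transSw : IndexSw n → PT (Fin n) :=
  nfSw hn (PTzeta n).subtype (td n) (tz n) (tz0 n)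

theorem transS_d_zero (m : PTzeta n) : transS hn (.inl (.inr m)) 0 = none := by
  simp [nfS, PT.mul_apply, td]

theorem transS_d (m : PTzeta n) (x : Fin n) (hx : x ≠ 0) :
    transS hn (.inl (.inr m)) x = (m : PT (Fin n)) x := by
  simp [nfS, PT.mul_apply, td, hx]

/-- In this family the index 0 encodes that the centre is outside the domain. In `transConst` it is
a genuine value. -/
theorem transS_collapse_zero (A : LeafSet n) (k : Fin n) :
    transS hn (.inr (.inl (A, k))) 0 = if k = 0 then none else some k := by
  simp only [nfS, Sum.elim_inr, Sum.elim_inl]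
  split_ifs with hk
  · simp [PT.mul_apply, td]
  · simp [PT.mul_apply, coe_collapseZ, collapse, tz, cycleZ, tb_pow_pred_one hn k hk]

theorem transS_collapse (A : LeafSet n) (k : Fin n) (x : Fin n) (hx : x ≠ 0) :
    transS hn (.inr (.inl (A, k))) x = if x ∈ A.1 then some 0 else none := by
  have h0 (k : ℕ) : (tb n ^ k) 0 = some 0 := PTzeta_pow_zero (tb_mem_PTzeta hn) k
  have h1 := one_ne_zero_fin hn
  simp only [nfS, Sum.elim_inr, Sum.elim_inl]
  split_ifs with hk hA hA <;>
    simp [PT.mul_apply, td, hx, coe_collapseZ, collapse, tz, cycleZ, hA, h1, h0]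

theorem transS_point_zero (j : {j : Fin n // j ≠ 0}) :
    transS hn (.inr (.inr j)) 0 = some j.1 := by
  simp [nfS, PT.mul_apply, coe_collapseZ, collapse, tz, cycleZ, tb_pow_pred_one hn j j.2]

theorem transS_point (j : {j : Fin n // j ≠ 0}) (x : Fin n) (hx : x ≠ 0) :
    transS hn (.inr (.inr j)) x = none := by
  simp [nfS, PT.mul_apply, coe_collapseZ, collapse, hx]

theorem transConst_apply (A : LeafSet n) (k : Fin n) (x : Fin n) :
    transConst hn (A, k) x = if x = 0 ∨ x ∈ A.1 then some k else none := by
  simp only [nfConst]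
  split_ifs with hk hA hA
  · simp [PT.mul_apply, partialIdZ, partialId, hA, tz0, hk]
  · simp [PT.mul_apply, partialIdZ, partialId, hA]
  · simp [PT.mul_apply, partialIdZ, partialId, hA, tz0, tz, cycleZ, tb_pow_pred_one hn k hk]
  · simp [PT.mul_apply, partialIdZ, partialId, hA]

theorem LeafSet.exists_mem (A : LeafSet n) : ∃ x ∈ A.1, x ≠ 0 := by
  obtain ⟨x, hx⟩ := A.2.1
  exact ⟨x, hx, fun h => A.2.2 (h ▸ hx)⟩

theorem LeafSet.ext_of_ne_zero {A B : LeafSet n} (h : ∀ x, x ≠ 0 → (x ∈ A.1 ↔ x ∈ B.1)) :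
    A = B := by
  refine Subtype.ext (Finset.ext fun x => ?_)
  by_cases hx : x = 0
  · subst hx
    simp [A.2.2, B.2.2]
  · exact h x hx

/-- The four families are told apart by the image of the centre (0, undefined, or a leaf) and by
whether some leaf is sent to 0. Within a family the indices are read off from values. -/
theorem transS_injective : Function.Injective (transS hn) := by
  refine Function.Injective.sumElim (Function.Injective.sumElim ?_ ?_ ?_)
    (Function.Injective.sumElim ?_ ?_ ?_) ?_
  · exact Subtype.val_injective
  · intro m m' h
    refine Subtype.ext (PT.ext_of_ne_zero (m.2.1.trans m'.2.1.symm) fun x hx => ?_)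
    rw [← transS_d hn m x hx, ← transS_d hn m' x hx]
    exact congrFun h x
  · intro m m' h
    have h0 : (m : PT (Fin n)) 0 = transS hn (.inl (.inr m')) 0 := congrFun h 0
    rw [transS_d_zero, m.2.1] at h0
    cases h0
  · rintro ⟨A, k⟩ ⟨B, l⟩ h
    have h' : transS hn (.inr (.inl (A, k))) = transS hn (.inr (.inl (B, l))) := h
    have h0 := congrFun h' 0
    rw [transS_collapse_zero, transS_collapse_zero] at h0
    have hkl : k = l := by
      split_ifs at h0 with h1 h2 h2
      · rw [h1, h2]
      · exact Option.some_inj.1 h0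
    refine Prod.ext (LeafSet.ext_of_ne_zero fun x hx => ?_) hkl
    have hx' := congrFun h' x
    rw [transS_collapse _ _ _ _ hx, transS_collapse _ _ _ _ hx] at hx'
    split_ifs at hx' with h1 h2 h2 <;> simp [h1, h2]
  · intro j l h
    have h0 := congrFun (show transS hn (.inr (.inr j)) = transS hn (.inr (.inr l)) from h) 0
    rw [transS_point_zero, transS_point_zero, Option.some_inj] at h0
    exact Subtype.ext h0
  · rintro ⟨A, k⟩ j h
    obtain ⟨x, hxA, hx⟩ := A.exists_mem
    have h0 := congrFun
      (show transS hn (.inr (.inl (A, k))) = transS hn (.inr (.inr j)) from h) x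
    rw [transS_collapse _ _ _ _ hx, transS_point _ _ _ hx, if_pos hxA] at h0
    cases h0
  · rintro (m | m) (⟨A, k⟩ | j) h
    · have h0 := congrFun
        (show (m : PT (Fin n)) = transS hn (.inr (.inl (A, k))) from h) 0
      rw [transS_collapse_zero, m.2.1] at h0
      split_ifs at h0 with hk
      exact hk (Option.some_inj.1 h0).symm
    · have h0 := congrFun (show (m : PT (Fin n)) = transS hn (.inr (.inr j)) from h) 0
      rw [transS_point_zero, m.2.1, Option.some_inj] at h0
      exact j.2 h0.symm
    · obtain ⟨x, hxA, hx⟩ := A.exists_mem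
      have h0 := congrFun
        (show transS hn (.inl (.inr m)) = transS hn (.inr (.inl (A, k))) from h) x
      rw [transS_collapse _ _ _ _ hx, transS_d _ _ _ hx, if_pos hxA] at h0
      exact m.2.2 _ _ hx h0 rfl
    · have h0 := congrFun
        (show transS hn (.inl (.inr m)) = transS hn (.inr (.inr j)) from h) 0
      rw [transS_point_zero, transS_d_zero] at h0
      cases h0

theorem transConst_injective : Function.Injective (transConst hn) := by
  rintro ⟨A, k⟩ ⟨B, l⟩ h
  have h0 := congrFun h 0
  rw [transConst_apply, transConst_apply, if_pos (.inl rfl), if_pos (.inl rfl),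
    Option.some_inj] at h0
  refine Prod.ext (LeafSet.ext_of_ne_zero fun x hx => ?_) h0
  have hx' := congrFun h x
  rw [transConst_apply, transConst_apply] at hx'
  simp only [hx, false_or] at hx'
  split_ifs at hx' with h1 h2 h2 <;> simp [h1, h2]

/-- These maps identify the centre with a leaf adjacent to it. This separates them from all the
other normal forms, which lie in `PsEnd (starGraph n)`. -/
theorem transConst_notMem_PsEnd (p : LeafSet n × Fin n) :
    transConst hn p ∉ PsEnd (starGraph n) := by
  obtain ⟨A, k⟩ := p
  obtain ⟨x, hxA, hx⟩ := A.exists_mem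
  intro h
  exact ((h 0 x k k (by simp [transConst_apply]) (by simp [transConst_apply, hxA])).1
    ⟨hx.symm, .inl rfl⟩).1 rfl

/-- Adjacency in the star means that exactly one endpoint is 0, and these maps preserve and reflect
being 0. -/
theorem PTzeta_le_PsEnd : PTzeta n ≤ PsEnd (starGraph n) := by
  intro α hα u v u' v' hu hv
  have key : ∀ x y, α x = some y → (x = 0 ↔ y = 0) := by
    intro x y h
    constructor
    · rintro rfl
      rw [hα.1, Option.some_inj] at h
      exact h.symm
    · rintro rfl
      by_contra hx
      exact hα.2 x 0 hx h rfl
  have h1 := key u u' hu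
  have h2 := key v v' hv
  change (u ≠ v ∧ _) ↔ (u' ≠ v' ∧ _)
  by_cases hu0 : u = 0 <;> by_cases hv0 : v = 0 <;> simp_all [eq_comm]

theorem td_mem_PsEnd : td n ∈ PsEnd (starGraph n) := by
  intro u v u' v' hu hv
  simp only [td] at hu hv
  split_ifs at hu hv
  rw [Option.some_inj] at hu hv
  rw [hu, hv]

theorem tz_mem_PsEnd (hn : 3 ≤ n) : tz n ∈ PsEnd (starGraph n) := by
  intro u v u' v' hu hv
  have h1 := one_ne_zero_fin hn
  simp only [tz, Option.some_inj] at hu hv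
  subst hu hv
  change (u ≠ v ∧ _) ↔ (_ ∧ _)
  by_cases hu0 : u = 0 <;> by_cases hv0 : v = 0 <;> simp_all [eq_comm]

theorem PsEnd_le_PswEnd {V : Type*} (G : SimpleGraph V) : PsEnd G ≤ PswEnd G := by
  intro α hα u v u' v' hu hv
  have h := hα u v u' v' hu hv
  exact ⟨fun h' => h.1 h'.1, fun h' => ⟨h.2 h', h'.ne⟩⟩

theorem tz0_mem_PswEnd : tz0 n ∈ PswEnd (starGraph n) := by
  intro u v u' v' hu hv
  simp only [tz0, Option.some_inj] at hu hv
  subst hu hv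
  simp

theorem nfS_mem {P : Type*} [Monoid P] (ι : PTzeta n →* P) (d z : P) (S : Submonoid P)
    (hι : ∀ m, ι m ∈ S) (hd : d ∈ S) (hz : z ∈ S) (i : IndexS n) : nfS hn ι d z i ∈ S := by
  rcases i with (m | m) | (⟨A, k⟩ | j)
  · exact hι m
  · exact S.mul_mem hd (hι m)
  · simp only [nfS, Sum.elim_inr, Sum.elim_inl]
    split_ifs
    · exact S.mul_mem (S.mul_mem hd (hι _)) hz
    · exact S.mul_mem (S.mul_mem (hι _) hz) (S.pow_mem (hι _) _)
  · exact S.mul_mem (S.mul_mem (hι _) hz) (S.pow_mem (hι _) _)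

theorem transSw_mem (i : IndexSw n) : transSw hn i ∈ PswEnd (starGraph n) := by
  have hz := PsEnd_le_PswEnd _ (tz_mem_PsEnd hn)
  have hι (m : PTzeta n) : (PTzeta n).subtype m ∈ PswEnd (starGraph n) :=
    PsEnd_le_PswEnd _ (PTzeta_le_PsEnd m.2)
  rcases i with i | ⟨A, k⟩
  · exact nfS_mem hn _ _ _ _ hι (PsEnd_le_PswEnd _ td_mem_PsEnd) hz i
  · simp only [nfSw, nfConst, Sum.elim_inr]
    split_ifs
    · exact mul_mem (hι _) tz0_mem_PswEnd
    · exact mul_mem (mul_mem (mul_mem (hι _) tz0_mem_PswEnd) hz) (pow_mem (hι _) _)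

theorem transSw_injective : Function.Injective (transSw hn) := by
  refine Function.Injective.sumElim (transS_injective hn) (transConst_injective hn) ?_
  intro i p h
  refine transConst_notMem_PsEnd hn p ?_
  change transS hn i = transConst hn p at h
  rw [← h]
  exact nfS_mem hn _ _ _ _ (fun m => PTzeta_le_PsEnd m.2) td_mem_PsEnd (tz_mem_PsEnd hn) i

open Classical in
/-- The non-zero points that `α` sends to `k`, provided there is one. -/
noncomputable def fibre (α : PT (Fin n)) (k : Fin n) (h : ∃ x, x ≠ 0 ∧ α x = some k) : LeafSet n :=
  ⟨({x | x ≠ 0 ∧ α x = some k} : Finset (Fin n)), by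
    obtain ⟨x, hx⟩ := h
    exact ⟨⟨x, by simpa using hx⟩, by simp⟩⟩

theorem mem_fibre (α : PT (Fin n)) (k : Fin n) (h : ∃ x, x ≠ 0 ∧ α x = some k) (x : Fin n)
    (hx : x ≠ 0) : x ∈ (fibre α k h).1 ↔ α x = some k := by
  simp [fibre, hx]

theorem eq_ite_of_forall {Ω : Type*} {o : Option Ω} {k : Ω} {p : Prop} [Decidable p]
    (h : ∀ y, o = some y → y = k) (hp : p ↔ o = some k) : o = if p then some k else none := by
  split_ifs with hk
  · exact hp.1 hk
  · rcases ho : o with _ | y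
    · rfl
    · exact absurd (hp.2 (by rw [ho, h y ho])) hk

/-- If one leaf goes to 0, then every leaf in the domain does, and the image of the centre decides
the family. If no leaf goes to 0, the centre is undefined (d m), fixed (m), or sent to a leaf k. In
the last case every leaf in the domain also goes to k. -/
theorem exists_transSw_eq {α : PT (Fin n)} (hα : α ∈ PswEnd (starGraph n)) :
    ∃ i, transSw hn i = α := by
  -- Two leaves cannot be sent to adjacent vertices.
  have hleaf : ∀ x y x' y', x ≠ 0 → y ≠ 0 → α x = some x' → α y = some y' →
      x' = 0 → y' = 0 := by
    intro x y x' y' hx hy hx' hy' h0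
    by_contra h1
    -- Distinct images, one of them 0, are adjacent; so the two leaves would be adjacent.
    have := (hα x y x' y' hx' hy').2 ⟨fun h => h1 (h ▸ h0), .inl h0⟩
    rcases this.1.2 with h | h
    · exact hx h
    · exact hy h
  by_cases hz : ∃ x, x ≠ 0 ∧ α x = some 0
  · have hall : ∀ y, y ≠ 0 → ∀ y', α y = some y' → y' = 0 := by
      obtain ⟨x, hx, hx0⟩ := hz
      exact fun y hy y' hy' => hleaf x y 0 y' hx hy hx0 hy' rfl
    have hval (x : Fin n) (hx : x ≠ 0) :
        α x = if x ∈ (fibre α 0 hz).1 then some 0 else none :=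
      eq_ite_of_forall (hall x hx) (mem_fibre α 0 hz x hx)
    rcases h0 : α 0 with _ | k
    · refine ⟨.inl (.inr (.inl (fibre α 0 hz, 0))), PT.ext_of_ne_zero ?_ fun x hx => ?_⟩
      · exact (transS_collapse_zero hn (fibre α 0 hz) 0).trans (by simp [h0])
      · exact (transS_collapse hn (fibre α 0 hz) 0 x hx).trans (hval x hx).symm
    · by_cases hk : k = 0
      · refine ⟨.inr (fibre α 0 hz, 0), PT.ext_of_ne_zero ?_ fun x hx => ?_⟩
        · exact (transConst_apply hn (fibre α 0 hz) 0 0).trans (by simp [h0, hk])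
        · refine (transConst_apply hn (fibre α 0 hz) 0 x).trans ?_
          simp only [hx, false_or]
          exact (hval x hx).symm
      · refine ⟨.inl (.inr (.inl (fibre α 0 hz, k))), PT.ext_of_ne_zero ?_ fun x hx => ?_⟩
        · exact (transS_collapse_zero hn (fibre α 0 hz) k).trans (by simp [h0, hk])
        · exact (transS_collapse hn (fibre α 0 hz) k x hx).trans (hval x hx).symm
  · push Not at hz
    rcases h0 : α 0 with _ | k
    -- The centre is put back as a fixed point; the factor `d` removes it again.
    · let m : PTzeta n := ⟨fun x => if x = 0 then some 0 else α x, by simp, by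
        intro x y hx h
        simp only [hx, if_false] at h
        rintro rfl
        exact hz x hx h⟩
      refine ⟨.inl (.inl (.inr m)), PT.ext_of_ne_zero ?_ fun x hx => ?_⟩
      · exact (transS_d_zero hn _).trans h0.symm
      · exact (transS_d hn _ x hx).trans (by simp [m, hx])
    · by_cases hk : k = 0
      · subst hk
        exact ⟨.inl (.inl (.inl ⟨α, h0, fun x y hx h hy => hz x hx (hy ▸ h)⟩)), rfl⟩
      · have hall : ∀ y, y ≠ 0 → ∀ y', α y = some y' → y' = k := by
          intro y hy y' hy'
          by_contra hne
          -- An edge with distinct end images maps to an edge, so one image is 0, which is excluded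
          -- for both.
          rcases ((hα 0 y k y' h0 hy').1 ⟨⟨hy.symm, .inl rfl⟩, Ne.symm hne⟩).2 with h | h
          · exact hk h
          · exact hz y hy (h ▸ hy')
        by_cases hz' : ∃ x, x ≠ 0 ∧ α x = some k
        · refine ⟨.inr (fibre α k hz', k), PT.ext_of_ne_zero ?_ fun x hx => ?_⟩
          · exact (transConst_apply hn (fibre α k hz') k 0).trans (by simp [h0])
          · refine (transConst_apply hn (fibre α k hz') k x).trans ?_
            simp only [hx, false_or]
            exact (eq_ite_of_forall (hall x hx) (mem_fibre α k hz' x hx)).symm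
        · push Not at hz'
          refine ⟨.inl (.inr (.inr ⟨k, hk⟩)), PT.ext_of_ne_zero ?_ fun x hx => ?_⟩
          · exact (transS_point_zero hn _).trans h0.symm
          · refine (transS_point hn _ x hx).trans ?_
            rcases hy : α x with _ | y
            · rfl
            · exact absurd (hall x hx y hy ▸ hy) (hz' x hx)

theorem range_transSw : Set.range (transSw hn) = PswEnd (starGraph n) := by
  ext α
  constructor
  · rintro ⟨i, rfl⟩
    exact transSw_mem hn i
  · exact exists_transSw_eq hn

theorem range_transS : Set.range (transS hn) = PsEnd (starGraph n) := by
  ext α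
  constructor
  · rintro ⟨i, rfl⟩
    exact nfS_mem hn _ _ _ _ (fun m => PTzeta_le_PsEnd m.2) td_mem_PsEnd (tz_mem_PsEnd hn) i
  · intro hα
    obtain ⟨i | p, rfl⟩ := exists_transSw_eq hn (PsEnd_le_PswEnd _ hα)
    · exact ⟨i, rfl⟩
    · exact absurd hα (transConst_notMem_PsEnd hn p)

theorem encard_PsEnd (hn : 3 ≤ n) : (PsEnd (starGraph n) : Set (PT (Fin n))).encard = Nat.card (IndexS n) := by
  rw [← range_transS hn, ← Set.image_univ, (transS_injective hn).encard_image,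
    Set.encard_univ, ENat.card_eq_coe_natCard]

theorem encard_PswEnd (hn : 3 ≤ n) :
    (PswEnd (starGraph n) : Set (PT (Fin n))).encard = Nat.card (IndexSw n) := by
  rw [← range_transSw hn, ← Set.image_univ, (transSw_injective hn).encard_image,
    Set.encard_univ, ENat.card_eq_coe_natCard]

variable (n) in
/-- An element of `PTzeta n` is determined by its values on the non-zero points, where the value
`0` stands for "undefined". -/
def PTzetaEquiv : PTzeta n ≃ ({x : Fin n // x ≠ 0} → Fin n) where
  toFun m x := ((m : PT (Fin n)) x.1).getD 0
  invFun h := ⟨fun x => if hx : x = 0 then some 0 else if h ⟨x, hx⟩ = 0 then none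
      else some (h ⟨x, hx⟩), by simp, by
    intro x y hx hy
    simp only [hx, dif_neg, not_false_eq_true] at hy
    split_ifs at hy with h0
    exact Option.some_inj.1 hy ▸ h0⟩
  left_inv m := by
    refine Subtype.ext (PT.ext_of_ne_zero ?_ fun x hx => ?_)
    · simp [m.2.1]
    · rcases hy : (m : PT (Fin n)) x with _ | y
      · simp [hx, hy]
      · simp [hx, hy, m.2.2 x y hx hy]
  right_inv h := by
    funext ⟨x, hx⟩
    by_cases h0 : h ⟨x, hx⟩ = 0 <;> simp [hx, h0]

theorem card_ne_zero : Nat.card {x : Fin n // x ≠ 0} = n - 1 := by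
  simp

theorem card_PTzeta : Nat.card (PTzeta n) = n ^ (n - 1) := by
  rw [Nat.card_congr (PTzetaEquiv n), Nat.card_fun, card_ne_zero, Nat.card_fin]

theorem card_leafSet : Nat.card (LeafSet n) = 2 ^ (n - 1) - 1 := by
  rw [Nat.subtype_card (((Finset.univ : Finset (Fin n)).erase 0).powerset.erase ∅)]
  · simp
  · intro A
    simp [Finset.nonempty_iff_ne_empty, Finset.subset_erase]

theorem card_indexSw :
    (Nat.card (IndexSw n) : ℤ) = 2 * (n : ℤ) ^ (n - 1) + n * 2 ^ n - n - 1 := by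
  -- This removes the truncated subtraction from the exponents, so that `ring` can relate the two
  -- powers of 2.
  obtain ⟨k, rfl⟩ : ∃ k, n = k + 1 := ⟨n - 1, (Nat.succ_pred_eq_of_ne_zero (NeZero.ne n)).symm⟩
  simp only [Nat.card_sum, Nat.card_prod, card_PTzeta, card_leafSet, card_ne_zero, Nat.card_fin,
    Nat.add_sub_cancel]
  push_cast [Nat.one_le_two_pow]
  ring

end Enumeration

/-! ### From the abstract normal forms to the presented monoids. -/

section Presentations

theorem pow_mul_of_mul_eq {M : Type*} [Monoid M] {x y : M} (h : x * y = y) (k : ℕ) :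
    x ^ k * y = y := by
  induction k with
  | zero => simp
  | succ k ih => rw [pow_succ, mul_assoc, h, ih]

/-- A map of alphabets that respects relations induces a homomorphism of presented monoids. -/
def presentedMap {X Y : Type*} {R : FreeMonoid X → FreeMonoid X → Prop}
    {S : FreeMonoid Y → FreeMonoid Y → Prop} (f : X → Y)
    (h : ∀ u v, R u v → S (FreeMonoid.map f u) (FreeMonoid.map f v)) :
    PresentedMonoid R →* PresentedMonoid S :=
  Con.lift _ ((PresentedMonoid.mk S).comp (FreeMonoid.map f))
    (Con.conGen_le.2 fun u v huv => PresentedMonoid.mk_eq_mk_of_rel (h u v huv))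

theorem presentedMap_mk {X Y : Type*} {R : FreeMonoid X → FreeMonoid X → Prop}
    {S : FreeMonoid Y → FreeMonoid Y → Prop} (f : X → Y)
    (h : ∀ u v, R u v → S (FreeMonoid.map f u) (FreeMonoid.map f v)) (u : FreeMonoid X) :
    presentedMap f h (PresentedMonoid.mk R u) = PresentedMonoid.mk S (FreeMonoid.map f u) := rfl

theorem conGen_map {X Y : Type*} {R : FreeMonoid X → FreeMonoid X → Prop}
    {S : FreeMonoid Y → FreeMonoid Y → Prop} (f : X → Y)
    (h : ∀ u v, R u v → S (FreeMonoid.map f u) (FreeMonoid.map f v)) {u v : FreeMonoid X}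
    (huv : conGen R u v) : conGen S (FreeMonoid.map f u) (FreeMonoid.map f v) := by
  rw [← PresentedMonoid.mk_eq_mk_iff, ← presentedMap_mk f h, ← presentedMap_mk f h,
    PresentedMonoid.mk_eq_mk_iff.2 huv]

/-- Sets of canonical forms have exactly as many elements as the monoid. -/
theorem IsCanonicalForms.encard_eq {X P : Type*} [Monoid P]
    {R : FreeMonoid X → FreeMonoid X → Prop} {M : Submonoid P} {g : X → P}
    {W : Set (FreeMonoid X)} (hW : IsCanonicalForms R M W) (hR : Defines R M g) :
    W.encard = (M : Set P).encard := by
  refine le_antisymm hW.2 ?_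
  obtain ⟨φ, -⟩ := hR
  have himg : PresentedMonoid.mk R '' W = Set.univ := by
    refine Set.eq_univ_of_forall fun x => ?_
    obtain ⟨w, rfl⟩ := PresentedMonoid.surjective_mk x
    obtain ⟨w', hw', h⟩ := hW.1 w
    exact ⟨w', hw', (PresentedMonoid.mk_eq_mk_iff.2 h).symm⟩
  calc (M : Set P).encard = ENat.card (PresentedMonoid R) := ENat.card_congr φ.symm.toEquiv
    _ = (PresentedMonoid.mk R '' W).encard := by rw [himg, Set.encard_univ]
    _ ≤ W.encard := Set.encard_image_le _ _

/-- Equivalent words in a set of canonical forms of a finite monoid are equal. -/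
theorem IsCanonicalForms.injOn_mk {X P : Type*} [Monoid P] [Finite P]
    {R : FreeMonoid X → FreeMonoid X → Prop} {M : Submonoid P} {g : X → P}
    {W : Set (FreeMonoid X)} (hW : IsCanonicalForms R M W) (hR : Defines R M g) :
    Set.InjOn (PresentedMonoid.mk R) W := by
  have hfin : W.Finite := by
    refine Set.finite_of_encard_le_coe (k := Nat.card M) (hW.2.trans (le_of_eq ?_))
    exact ENat.card_eq_coe_natCard M
  refine hfin.injOn_of_encard_image_eq ?_
  have himg : PresentedMonoid.mk R '' W = Set.univ := by
    refine Set.eq_univ_of_forall fun x => ?_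
    obtain ⟨w, rfl⟩ := PresentedMonoid.surjective_mk x
    obtain ⟨w', hw', h⟩ := hW.1 w
    exact ⟨w', hw', (PresentedMonoid.mk_eq_mk_iff.2 h).symm⟩
  rw [himg, hW.encard_eq hR, Set.encard_univ]
  obtain ⟨φ, -⟩ := hR
  exact ENat.card_congr φ.toEquiv

variable {n : ℕ} [NeZero n] {R₀ : FreeMonoid L0 → FreeMonoid L0 → Prop}

theorem coe_iso_mk {φ : PresentedMonoid R₀ ≃* PTzeta n}
    (hφ : ∀ x, (φ (PresentedMonoid.of R₀ x) : PT (Fin n)) = L0.gen n x) (u : FreeMonoid L0) :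
    (φ (PresentedMonoid.mk R₀ u) : PT (Fin n)) = L0.eval n u := by
  have : ((PTzeta n).subtype.comp φ.toMonoidHom).comp (PresentedMonoid.mk R₀) = L0.eval n :=
    FreeMonoid.hom_eq fun x => (hφ x).trans (FreeMonoid.lift_eval_of _ _).symm
  exact DFunLike.congr_fun this u

theorem eval_eq_of_rel (hR₀ : Defines R₀ (PTzeta n) (L0.gen n)) {u v : FreeMonoid L0}
    (h : R₀ u v) : L0.eval n u = L0.eval n v := by
  obtain ⟨φ, hφ⟩ := hR₀
  rw [← coe_iso_mk hφ, ← coe_iso_mk hφ, PresentedMonoid.mk_eq_mk_of_rel h]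

/-- This is where the presentation by `R₀` enters: every identity between words that holds in
`PTzeta n` may be used as a relation. -/
theorem conGen_of_eval_eq (hR₀ : Defines R₀ (PTzeta n) (L0.gen n)) {u v : FreeMonoid L0}
    (h : L0.eval n u = L0.eval n v) : conGen R₀ u v := by
  obtain ⟨φ, hφ⟩ := hR₀
  rw [← PresentedMonoid.mk_eq_mk_iff]
  refine φ.injective (Subtype.ext ?_)
  rw [coe_iso_mk hφ, coe_iso_mk hφ, h]

theorem exists_eval_eq (hR₀ : Defines R₀ (PTzeta n) (L0.gen n)) (m : PTzeta n) :
    ∃ u, L0.eval n u = m := by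
  obtain ⟨φ, hφ⟩ := hR₀
  obtain ⟨u, hu⟩ := PresentedMonoid.surjective_mk (φ.symm m)
  exact ⟨u, by rw [← coe_iso_mk hφ, hu, φ.apply_symm_apply]⟩

/-- A word representing a given element of `PTzeta n`. -/
noncomputable def wordOf (hR₀ : Defines R₀ (PTzeta n) (L0.gen n)) (m : PTzeta n) :
    FreeMonoid L0 := (exists_eval_eq hR₀ m).choose

theorem eval_wordOf (hR₀ : Defines R₀ (PTzeta n) (L0.gen n)) (m : PTzeta n) :
    L0.eval n (wordOf hR₀ m) = m := (exists_eval_eq hR₀ m).choose_spec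

theorem eval_eq_pow_fb (hn : 3 ≤ n) :
    L0.eval n ((L0.wf * L0.wb) ^ (n - 1)) = collapse n ∅ := by
  rw [← tf_mul_tb_pow_pred hn, map_pow, map_mul]
  rfl

theorem eval_eq_pow_eb (hn : 3 ≤ n) :
    L0.eval n ((L0.we * L0.wb) ^ (n - 3) * L0.we) = collapse n (Finset.univ.erase 0) := by
  rw [← te_mul_tb_pow_mul_te_eq_collapse hn, map_mul, map_pow, map_mul]
  rfl

/-- The image of `PTzeta n` in the monoid presented by `R_s`. -/
noncomputable def baseS (hR₀ : Defines R₀ (PTzeta n) (L0.gen n)) :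
    PTzeta n →* PresentedMonoid (Ls.Rel n R₀) where
  toFun m := PresentedMonoid.mk _ (inclS (wordOf hR₀ m))
  map_one' := by
    rw [← map_one (PresentedMonoid.mk (Ls.Rel n R₀)), ← map_one inclS,
      PresentedMonoid.mk_eq_mk_iff]
    refine conGen_map Ls.base Ls.Rel.base (conGen_of_eval_eq hR₀ ?_)
    rw [eval_wordOf, map_one]
    rfl
  map_mul' m m' := by
    rw [← map_mul, ← map_mul, PresentedMonoid.mk_eq_mk_iff]
    refine conGen_map Ls.base Ls.Rel.base (conGen_of_eval_eq hR₀ ?_)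
    rw [map_mul, eval_wordOf, eval_wordOf, eval_wordOf]
    rfl

theorem baseS_eq (hR₀ : Defines R₀ (PTzeta n) (L0.gen n)) (m : PTzeta n) (u : FreeMonoid L0)
    (h : L0.eval n u = m) : baseS hR₀ m = PresentedMonoid.mk (Ls.Rel n R₀) (inclS u) := by
  refine PresentedMonoid.mk_eq_mk_iff.2
    (conGen_map Ls.base Ls.Rel.base (conGen_of_eval_eq hR₀ ?_))
  rw [eval_wordOf, h]

variable (n R₀) in
/-- The canonical map from the monoid presented by `R_s` to the one presented by `R_sw`. -/
def toSw : PresentedMonoid (Ls.Rel n R₀) →* PresentedMonoid (Lsw.Rel n R₀) :=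
  presentedMap Lsw.base Lsw.Rel.base

theorem toSw_mk {n : ℕ} {R₀ : FreeMonoid L0 → FreeMonoid L0 → Prop} (u : FreeMonoid Ls) :
    toSw n R₀ (PresentedMonoid.mk _ u) = PresentedMonoid.mk _ (inclSw u) := rfl

/-- The relations on letters extend to all of `PTzeta n`: commutation with d by induction on words,
and c z = z because c is a word in `e₀` and `b₀`, both absorbed by z. -/
theorem isStarPair_presented (hn : 3 ≤ n) (hR₀ : Defines R₀ (PTzeta n) (L0.gen n)) :
    IsStarPair hn (baseS hR₀) (PresentedMonoid.mk (Ls.Rel n R₀) Ls.wd)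
      (PresentedMonoid.mk (Ls.Rel n R₀) Ls.wz) where
  d_mul_d := by
    rw [← map_mul, ← pow_two]
    exact PresentedMonoid.mk_eq_mk_of_rel .d_sq
  comm m := by
    obtain ⟨u, hu⟩ := exists_eval_eq hR₀ m
    rw [baseS_eq hR₀ m u hu]
    clear hu
    induction u with
    | one => simp
    | of x =>
      rw [← map_mul, ← map_mul]
      cases x
      · exact PresentedMonoid.mk_eq_mk_of_rel .a_d
      · exact PresentedMonoid.mk_eq_mk_of_rel .b_d
      · exact PresentedMonoid.mk_eq_mk_of_rel .e_d
      · exact PresentedMonoid.mk_eq_mk_of_rel .f_d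
    | mul u v hu hv => rw [map_mul, map_mul, mul_assoc, hv, ← mul_assoc, hu, mul_assoc]
  collapse_mul_z := by
    have he : PresentedMonoid.mk (Ls.Rel n R₀) Ls.we * PresentedMonoid.mk _ Ls.wz =
        PresentedMonoid.mk _ Ls.wz := by
      rw [← map_mul]
      exact PresentedMonoid.mk_eq_mk_of_rel .e_z
    have hb : PresentedMonoid.mk (Ls.Rel n R₀) Ls.wb * PresentedMonoid.mk _ Ls.wz =
        PresentedMonoid.mk _ Ls.wz := by
      rw [← map_mul]
      exact PresentedMonoid.mk_eq_mk_of_rel .b_z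
    rw [baseS_eq hR₀ _ _ (eval_eq_pow_eb hn)]
    simp only [map_mul, map_pow]
    change (PresentedMonoid.mk _ Ls.we * PresentedMonoid.mk _ Ls.wb) ^ (n - 3) *
      PresentedMonoid.mk _ Ls.we * _ = _
    rw [mul_assoc, he]
    exact pow_mul_of_mul_eq (by rw [mul_assoc, hb, he]) _
  d_mul_z := by
    rw [baseS_eq hR₀ _ L0.wf rfl, ← map_mul, ← map_mul]
    exact PresentedMonoid.mk_eq_mk_of_rel .d_z
  z_mul_d := by
    rw [baseS_eq hR₀ _ _ (eval_eq_pow_fb hn), ← map_mul, ← map_mul]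
    exact PresentedMonoid.mk_eq_mk_of_rel (by simpa [inclS] using Ls.Rel.z_d (n := n) (R₀ := R₀))
  z_mul_z := by
    rw [baseS_eq hR₀ _ _ (eval_eq_pow_eb hn), ← map_mul, ← pow_two]
    exact PresentedMonoid.mk_eq_mk_of_rel (by simpa [inclS] using Ls.Rel.z_sq (n := n) (R₀ := R₀))
  d_empty_z := by
    rw [baseS_eq hR₀ _ _ (eval_eq_pow_fb hn), ← map_mul, ← map_mul]
    exact PresentedMonoid.mk_eq_mk_of_rel
      (by simpa [inclS] using Ls.Rel.d_fb_z (n := n) (R₀ := R₀))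

theorem IsStarPair.map {hn : 3 ≤ n} {P Q : Type*} [Monoid P] [Monoid Q] {ι : PTzeta n →* P}
    {d z : P} (H : IsStarPair hn ι d z) (f : P →* Q) :
    IsStarPair hn (f.comp ι) (f d) (f z) where
  d_mul_d := by rw [← map_mul, H.d_mul_d]
  comm m := by rw [MonoidHom.comp_apply, ← map_mul, H.comm, map_mul]
  collapse_mul_z := by rw [MonoidHom.comp_apply, ← map_mul, H.collapse_mul_z]
  d_mul_z := by rw [MonoidHom.comp_apply, ← map_mul, H.d_mul_z, map_mul]
  z_mul_d := by rw [MonoidHom.comp_apply, ← map_mul, H.z_mul_d, map_mul]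
  z_mul_z := by rw [MonoidHom.comp_apply, ← map_mul, H.z_mul_z]
  d_empty_z := by rw [MonoidHom.comp_apply, ← map_mul, ← map_mul, H.d_empty_z]

/-- The image of `PTzeta n` in the monoid presented by `R_sw`. -/
noncomputable def baseSw (hR₀ : Defines R₀ (PTzeta n) (L0.gen n)) :
    PTzeta n →* PresentedMonoid (Lsw.Rel n R₀) := (toSw n R₀).comp (baseS hR₀)

theorem baseSw_eq (hR₀ : Defines R₀ (PTzeta n) (L0.gen n)) (m : PTzeta n) (u : FreeMonoid L0)
    (h : L0.eval n u = m) :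
    baseSw hR₀ m = PresentedMonoid.mk (Lsw.Rel n R₀) (inclSw (inclS u)) := by
  rw [baseSw, MonoidHom.comp_apply, baseS_eq hR₀ m u h, toSw_mk]

theorem isStarTriple_presented (hn : 3 ≤ n) (hR₀ : Defines R₀ (PTzeta n) (L0.gen n)) :
    IsStarTriple hn (baseSw hR₀) (PresentedMonoid.mk (Lsw.Rel n R₀) Lsw.wd)
      (PresentedMonoid.mk (Lsw.Rel n R₀) Lsw.wz) (PresentedMonoid.mk (Lsw.Rel n R₀) Lsw.wz0) where
  toIsStarPair := (isStarPair_presented hn hR₀).map (toSw n R₀)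
  collapse_mul_z₀ := by
    have hz : PresentedMonoid.mk (Lsw.Rel n R₀) Lsw.wz * PresentedMonoid.mk _ Lsw.wz0 =
        PresentedMonoid.mk _ Lsw.wz0 := by
      rw [← map_mul]
      exact PresentedMonoid.mk_eq_mk_of_rel .z_z0
    conv_lhs => rw [← hz]
    have := ((isStarPair_presented hn hR₀).map (toSw n R₀)).collapse_mul_z
    rw [← mul_assoc]
    conv_rhs => rw [← hz]
    exact congrArg (· * PresentedMonoid.mk (Lsw.Rel n R₀) Lsw.wz0) this
  z_mul_z₀ := by
    rw [← map_mul]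
    exact PresentedMonoid.mk_eq_mk_of_rel .z_z0
  z₀_mul m := by
    obtain ⟨u, hu⟩ := exists_eval_eq hR₀ m
    rw [baseSw_eq hR₀ m u hu]
    clear hu
    induction u with
    | one => simp
    | of x =>
      rw [← map_mul]
      cases x
      · exact PresentedMonoid.mk_eq_mk_of_rel .z0_a
      · exact PresentedMonoid.mk_eq_mk_of_rel .z0_b
      · exact PresentedMonoid.mk_eq_mk_of_rel .z0_e
      · exact PresentedMonoid.mk_eq_mk_of_rel .z0_f
    | mul u v hu hv => rw [map_mul, map_mul, map_mul, ← mul_assoc, hu, hv]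
  d_mul_z₀ := by
    rw [← map_mul, ← map_mul]
    exact PresentedMonoid.mk_eq_mk_of_rel .d_z0
  z₀_mul_d := by
    rw [baseSw_eq hR₀ _ _ (eval_eq_pow_fb hn), ← map_mul, ← map_mul]
    exact PresentedMonoid.mk_eq_mk_of_rel
      (by simpa [inclS, inclSw] using Lsw.Rel.z0_d (n := n) (R₀ := R₀))

/-- Words are built by adding letters on the left, so closure under left multiplication is enough.
That `R_s` defines `PsEnd (starGraph n)` is not needed. -/
theorem nfS_surjective (hn : 3 ≤ n) (hR₀ : Defines R₀ (PTzeta n) (L0.gen n)) :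
    Function.Surjective (nfS hn (baseS hR₀) (PresentedMonoid.mk (Ls.Rel n R₀) Ls.wd)
      (PresentedMonoid.mk (Ls.Rel n R₀) Ls.wz)) := by
  have H := isStarPair_presented hn hR₀
  intro x
  obtain ⟨w, rfl⟩ := PresentedMonoid.surjective_mk x
  induction w using FreeMonoid.inductionOn' with
  | one =>
    rw [map_one, ← map_one (baseS hR₀)]
    exact IsStarPair.mem_range_one 1
  | of_mul x w ih =>
    rw [map_mul]
    rcases x with x | _ | _
    · obtain ⟨φ, hφ⟩ := id hR₀
      have hx : baseS hR₀ (φ (PresentedMonoid.of R₀ x)) =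
          PresentedMonoid.mk (Ls.Rel n R₀) (FreeMonoid.of (Ls.base x)) :=
        baseS_eq hR₀ _ (FreeMonoid.of x) (hφ x).symm
      rw [← hx]
      exact H.ι_mul_mem _ _ ih
    · exact H.d_mul_mem _ ih
    · exact H.z_mul_mem _ ih

theorem nfSw_surjective (hn : 3 ≤ n) (hR₀ : Defines R₀ (PTzeta n) (L0.gen n)) :
    Function.Surjective (nfSw hn (baseSw hR₀) (PresentedMonoid.mk (Lsw.Rel n R₀) Lsw.wd)
      (PresentedMonoid.mk (Lsw.Rel n R₀) Lsw.wz) (PresentedMonoid.mk (Lsw.Rel n R₀) Lsw.wz0)) := by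
  have H := isStarTriple_presented hn hR₀
  intro x
  obtain ⟨w, rfl⟩ := PresentedMonoid.surjective_mk x
  induction w using FreeMonoid.inductionOn' with
  | one =>
    rw [map_one, ← map_one (baseSw hR₀)]
    exact IsStarTriple.mem_range_inl (IsStarPair.mem_range_one 1)
  | of_mul x w ih =>
    rw [map_mul]
    rcases x with (x | _ | _) | _
    · obtain ⟨φ, hφ⟩ := id hR₀
      have hx : baseSw hR₀ (φ (PresentedMonoid.of R₀ x)) =
          PresentedMonoid.mk (Lsw.Rel n R₀) (FreeMonoid.of (Lsw.base (Ls.base x))) :=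
        baseSw_eq hR₀ _ (FreeMonoid.of x) (hφ x).symm
      rw [← hx]
      exact H.ι_mul_mem _ _ ih
    · exact H.d_mul_mem _ ih
    · exact H.z_mul_mem _ ih
    · exact H.z₀_mul_mem _ ih

theorem lift_gen_inclSw_inclS (u : FreeMonoid L0) :
    FreeMonoid.lift (Lsw.gen n) (inclSw (inclS u)) = L0.eval n u := by
  have : ((FreeMonoid.lift (Lsw.gen n)).comp inclSw).comp inclS = L0.eval n :=
    FreeMonoid.hom_eq fun x => rfl
  exact DFunLike.congr_fun this u

/-- Soundness of the relations: all of `PTzeta n` commutes with d, and its full transformations are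
absorbed by z, which only distinguishes 0 from the leaves. -/
theorem lift_gen_eq_of_rel_s (hn : 3 ≤ n) (hR₀ : Defines R₀ (PTzeta n) (L0.gen n))
    {u v : FreeMonoid Ls} (h : Ls.Rel n R₀ u v) :
    FreeMonoid.lift (Lsw.gen n) (inclSw u) = FreeMonoid.lift (Lsw.gen n) (inclSw v) := by
  have h1 := one_ne_zero_fin hn
  have hcomm : ∀ α ∈ PTzeta n, α * td n = td n * α := by
    intro α hα
    refine PT.ext_of_ne_zero ?_ fun x hx => ?_
    · simp [PT.mul_apply, hα.1, td]
    · rcases hy : α x with _ | y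
      · simp [PT.mul_apply, hy, td, hx]
      · simp [PT.mul_apply, hy, td, hx, hα.2 x y hx hy]
  have hz : ∀ α ∈ PTzeta n, (∀ x, α x ≠ none) → α * tz n = tz n := by
    intro α hα hfull
    refine PT.ext_of_ne_zero ?_ fun x hx => ?_
    · simp [PT.mul_apply, hα.1]
    · rcases hy : α x with _ | y
      · exact absurd hy (hfull x)
      · simp [PT.mul_apply, hy, tz, hx, hα.2 x y hx hy]
  cases h with
  | base u v h => rw [lift_gen_inclSw_inclS, lift_gen_inclSw_inclS, eval_eq_of_rel hR₀ h]
  | d_sq =>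
    rw [pow_two, map_mul, map_mul]
    change td n * td n = td n
    refine PT.ext_of_ne_zero ?_ fun x hx => ?_ <;> simp_all [PT.mul_apply, td]
  | a_d => exact hcomm _ (ta_mem_PTzeta hn)
  | b_d => exact hcomm _ (tb_mem_PTzeta hn)
  | e_d => exact hcomm _ (te_mem_PTzeta hn)
  | f_d => exact hcomm _ (tf_mem_PTzeta hn)
  | a_z => exact hz (ta n) (ta_mem_PTzeta hn) (by simp [ta])
  | b_z => exact hz (tb n) (tb_mem_PTzeta hn) (by simp [tb])
  | e_z => exact hz (te n) (te_mem_PTzeta hn) (by simp [te])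
  | d_z =>
    change td n * tz n = tz n * tf n
    refine PT.ext_of_ne_zero ?_ fun x hx => ?_
    · simp [PT.mul_apply, td, tz, tf]
    · simp [PT.mul_apply, td, tz, tf, hx, h1.symm]
  | z_d =>
    simp only [map_mul, map_pow]
    change tz n * td n = (tf n * tb n) ^ (n - 1) * tz n
    rw [tf_mul_tb_pow_pred hn]
    refine PT.ext_of_ne_zero ?_ fun x hx => ?_ <;> simp_all [PT.mul_apply, td, tz, collapse]
  | z_sq =>
    simp only [map_mul, map_pow]
    change tz n ^ 2 = (te n * tb n) ^ (n - 3) * te n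
    rw [te_mul_tb_pow_mul_te_eq_collapse hn, pow_two]
    refine PT.ext_of_ne_zero ?_ fun x hx => ?_ <;> simp_all [PT.mul_apply, tz, collapse]
  | d_fb_z =>
    simp only [map_mul, map_pow]
    change td n * (tf n * tb n) ^ (n - 1) * tz n = td n * (tf n * tb n) ^ (n - 1)
    rw [tf_mul_tb_pow_pred hn]
    refine PT.ext_of_ne_zero ?_ fun x hx => ?_ <;> simp_all [PT.mul_apply, td, collapse]

theorem lift_gen_eq_of_rel (hn : 3 ≤ n) (hR₀ : Defines R₀ (PTzeta n) (L0.gen n))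
    (u v : FreeMonoid Lsw) (h : Lsw.Rel n R₀ u v) :
    FreeMonoid.lift (Lsw.gen n) u = FreeMonoid.lift (Lsw.gen n) v := by
  have h1 := one_ne_zero_fin hn
  have hz0 : ∀ α ∈ PTzeta n, tz0 n * α = tz0 n := fun α hα =>
    funext fun x => by simp [PT.mul_apply, tz0, hα.1]
  cases h with
  | base u v h => exact lift_gen_eq_of_rel_s hn hR₀ h
  | b_z0 => exact (funext fun x => by simp [PT.mul_apply, tz0, tb] : tb n * tz0 n = tz0 n)
  | z_z0 => exact (funext fun x => by simp [PT.mul_apply, tz0, tz] : tz n * tz0 n = tz0 n)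
  | z0_a => exact hz0 _ (ta_mem_PTzeta hn)
  | z0_b => exact hz0 _ (tb_mem_PTzeta hn)
  | z0_e => exact hz0 _ (te_mem_PTzeta hn)
  | z0_f => exact hz0 _ (tf_mem_PTzeta hn)
  | d_z0 =>
    change td n * tz0 n = td n * tz n
    refine PT.ext_of_ne_zero ?_ fun x hx => ?_ <;> simp_all [PT.mul_apply, td, tz, tz0]
  | z0_d =>
    simp only [map_mul, map_pow]
    change tz0 n * td n = td n * (tf n * tb n) ^ (n - 1)
    rw [tf_mul_tb_pow_pred hn]
    refine PT.ext_of_ne_zero ?_ fun x hx => ?_ <;> simp_all [PT.mul_apply, td, tz0, collapse]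

/-- The transformation represented by an element of the monoid presented by `R_sw`. -/
def evalSw (hn : 3 ≤ n) (hR₀ : Defines R₀ (PTzeta n) (L0.gen n)) :
    PresentedMonoid (Lsw.Rel n R₀) →* PT (Fin n) :=
  PresentedMonoid.lift (Lsw.gen n) (lift_gen_eq_of_rel hn hR₀)

theorem evalSw_mk (hn : 3 ≤ n) (hR₀ : Defines R₀ (PTzeta n) (L0.gen n)) (w : FreeMonoid Lsw) :
    evalSw hn hR₀ (PresentedMonoid.mk _ w) = FreeMonoid.lift (Lsw.gen n) w := rfl

theorem evalSw_nfSw (hn : 3 ≤ n) (hR₀ : Defines R₀ (PTzeta n) (L0.gen n)) (i : IndexSw n) :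
    evalSw hn hR₀ (nfSw hn (baseSw hR₀) (PresentedMonoid.mk (Lsw.Rel n R₀) Lsw.wd)
      (PresentedMonoid.mk (Lsw.Rel n R₀) Lsw.wz) (PresentedMonoid.mk (Lsw.Rel n R₀) Lsw.wz0) i) =
      transSw hn i := by
  have h : (evalSw hn hR₀).comp (baseSw hR₀) = (PTzeta n).subtype := by
    ext m : 1
    rw [MonoidHom.comp_apply, baseSw_eq hR₀ m _ (eval_wordOf hR₀ m), evalSw_mk,
      lift_gen_inclSw_inclS, eval_wordOf]
    rfl
  rw [map_nfSw, h]
  rfl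

/-- Two elements with the same image are normal forms of the same transformation, hence have the
same index. -/
theorem evalSw_injective (hn : 3 ≤ n) (hR₀ : Defines R₀ (PTzeta n) (L0.gen n)) :
    Function.Injective (evalSw hn hR₀) := by
  intro x y h
  obtain ⟨i, rfl⟩ := nfSw_surjective hn hR₀ x
  obtain ⟨j, rfl⟩ := nfSw_surjective hn hR₀ y
  rw [evalSw_nfSw, evalSw_nfSw] at h
  rw [transSw_injective hn h]

theorem range_evalSw (hn : 3 ≤ n) (hR₀ : Defines R₀ (PTzeta n) (L0.gen n)) :
    Set.range (evalSw hn hR₀) = PswEnd (starGraph n) := by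
  rw [← range_transSw hn, ← (nfSw_surjective hn hR₀).range_comp]
  exact congrArg Set.range (funext fun i => evalSw_nfSw hn hR₀ i)

theorem defines_PswEnd (hn : 3 ≤ n) (hR₀ : Defines R₀ (PTzeta n) (L0.gen n)) :
    Defines (Lsw.Rel n R₀) (PswEnd (starGraph n)) (Lsw.gen n) := by
  have hrange (α : PT (Fin n)) : (∃ x, evalSw hn hR₀ x = α) ↔ α ∈ PswEnd (starGraph n) :=
    Set.ext_iff.1 (range_evalSw hn hR₀) α
  let f := (evalSw hn hR₀).codRestrict (PswEnd (starGraph n)) fun x => (hrange _).1 ⟨x, rfl⟩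
  refine ⟨MulEquiv.ofBijective f ⟨fun x y h => ?_, fun α => ?_⟩, fun _ => rfl⟩
  · exact evalSw_injective hn hR₀ (congrArg Subtype.val h)
  · obtain ⟨x, hx⟩ := (hrange α).2 α.2
    exact ⟨x, Subtype.ext hx⟩

end Presentations

/-! ### Words for the normal forms. -/

section CanonicalForms

variable {n : ℕ} [NeZero n] {R₀ : FreeMonoid L0 → FreeMonoid L0 → Prop}

/-- The words `ω A z₀` and `ω A z₀ z b₀ ^ (k - 1)`. -/
def constWord (ω : Finset (Fin n) → FreeMonoid L0) (p : LeafSet n × Fin n) : FreeMonoid Lsw :=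
  if p.2 = 0 then inclSw (inclS (ω p.1)) * Lsw.wz0
  else inclSw (inclS (ω p.1)) * Lsw.wz0 * Lsw.wz * Lsw.wb ^ ((p.2 : ℕ) - 1)

theorem range_constWord (hn : 3 ≤ n) (ω : Finset (Fin n) → FreeMonoid L0) :
    Set.range (constWord ω) = W5 n ω ∪ W6 n ω := by
  ext w
  constructor
  · rintro ⟨⟨A, k⟩, rfl⟩
    by_cases hk : k = 0
    · exact .inl ⟨A, A.2.1, A.2.2, by simp [constWord, hk]⟩
    · exact .inr ⟨A, A.2.1, A.2.2, k - 1, by omega, by simp [constWord, hk]⟩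
  · rintro (⟨A, hA, h0, rfl⟩ | ⟨A, hA, h0, k, hk, rfl⟩)
    · exact ⟨(⟨A, hA, h0⟩, 0), by simp [constWord]⟩
    -- The word ending in `b₀ ^ k` represents a constant map with value k + 1.
    · refine ⟨(⟨A, hA, h0⟩, ⟨k + 1, by omega⟩), ?_⟩
      have : (⟨k + 1, by omega⟩ : Fin n) ≠ 0 := by rw [Ne, eq_zero_iff_val]; simp
      simp [constWord, this]

theorem eval_idWord (ω : Finset (Fin n) → FreeMonoid L0) (hω : IsIdWords n ω) (A : LeafSet n) :
    L0.eval n (ω A) = partialId n A := by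
  have hsub : A.1 ⊆ Finset.univ.erase 0 := Finset.subset_erase.2 ⟨Finset.subset_univ _, A.2.2⟩
  rcases hsub.ssubset_or_eq with h | h
  · exact (hω.1 A A.2.1 h).2
  · rw [h, hω.2, partialId_univ_erase, map_one]

theorem baseS_cycleZ_pow (hn : 3 ≤ n) (hR₀ : Defines R₀ (PTzeta n) (L0.gen n)) (k : ℕ) :
    baseS hR₀ (cycleZ hn) ^ k = PresentedMonoid.mk (Ls.Rel n R₀) (Ls.wb ^ k) := by
  rw [baseS_eq hR₀ (cycleZ hn) L0.wb rfl, map_pow]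
  rfl

theorem baseSw_cycleZ_pow (hn : 3 ≤ n) (hR₀ : Defines R₀ (PTzeta n) (L0.gen n)) (k : ℕ) :
    baseSw hR₀ (cycleZ hn) ^ k = PresentedMonoid.mk (Lsw.Rel n R₀) (Lsw.wb ^ k) := by
  rw [baseSw_eq hR₀ (cycleZ hn) L0.wb rfl, map_pow]
  rfl

theorem mk_constWord (hn : 3 ≤ n) (hR₀ : Defines R₀ (PTzeta n) (L0.gen n))
    (ω : Finset (Fin n) → FreeMonoid L0) (hω : IsIdWords n ω) (p : LeafSet n × Fin n) :
    PresentedMonoid.mk (Lsw.Rel n R₀) (constWord ω p) =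
      nfConst hn (baseSw hR₀) (PresentedMonoid.mk (Lsw.Rel n R₀) Lsw.wz)
        (PresentedMonoid.mk (Lsw.Rel n R₀) Lsw.wz0) p := by
  simp only [constWord, nfConst, baseSw_cycleZ_pow,
    baseSw_eq hR₀ (partialIdZ p.1) _ (eval_idWord ω hω p.1)]
  split_ifs <;> simp only [map_mul]

/-- A normal form without z₀ comes from the monoid presented by `R_s`, where `V` supplies a word.
The others are the words of `constWord`. The size bound is additive, matching the sum that defines
`IndexSw n`. -/
theorem isCanonicalForms_Wsw (hn : 3 ≤ n) (hR₀ : Defines R₀ (PTzeta n) (L0.gen n))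
    (ω : Finset (Fin n) → FreeMonoid L0) (hω : IsIdWords n ω) (V : Set (FreeMonoid Ls))
    (hV : IsCanonicalForms (Ls.Rel n R₀) (PsEnd (starGraph n)) V) :
    IsCanonicalForms (Lsw.Rel n R₀) (PswEnd (starGraph n)) (Wsw n V ω) := by
  rw [Wsw, Set.union_assoc, ← range_constWord hn]
  constructor
  · intro w
    obtain ⟨i | p, hi⟩ := nfSw_surjective hn hR₀ (PresentedMonoid.mk _ w)
    · obtain ⟨u, hu⟩ := PresentedMonoid.surjective_mk
        (nfS hn (baseS hR₀) (PresentedMonoid.mk (Ls.Rel n R₀) Ls.wd)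
          (PresentedMonoid.mk (Ls.Rel n R₀) Ls.wz) i)
      obtain ⟨v, hv, huv⟩ := hV.1 u
      refine ⟨inclSw v, .inl ⟨v, hv, rfl⟩, ?_⟩
      rw [← PresentedMonoid.mk_eq_mk_iff, ← hi, ← toSw_mk, ← PresentedMonoid.mk_eq_mk_iff.2 huv,
        hu, map_nfS]
      rfl
    · refine ⟨constWord ω p, .inr ⟨p, rfl⟩, ?_⟩
      rw [← PresentedMonoid.mk_eq_mk_iff, ← hi, mk_constWord hn hR₀ ω hω]
      rfl
  · calc (inclSw '' V ∪ Set.range (constWord ω)).encard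
        ≤ (inclSw '' V).encard + (Set.range (constWord ω)).encard := Set.encard_union_le _ _
      _ ≤ Nat.card (IndexS n) + Nat.card (LeafSet n × Fin n) := by
        refine add_le_add ?_ ?_
        · rw [← encard_PsEnd hn]
          exact (Set.encard_image_le _ _).trans hV.2
        · rw [← Set.image_univ, ← ENat.card_eq_coe_natCard, ← Set.encard_univ]
          exact Set.encard_image_le _ _
      _ = (PswEnd (starGraph n) : Set (PT (Fin n))).encard := by
        rw [encard_PswEnd hn, Nat.card_sum (α := IndexS n), Nat.cast_add]

/-- The words of `Ws n W₀`, where `r m` is the word of `W₀` representing `m`. -/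
def sWord (hn : 3 ≤ n) (r : PTzeta n → FreeMonoid L0) : IndexS n → FreeMonoid Ls :=
  Sum.elim (Sum.elim (fun m => inclS (r m)) fun m => Ls.wd * inclS (r m))
    (Sum.elim
      (fun p => if p.2 = 0 then Ls.wd * inclS (r (collapseZ hn p.1)) * Ls.wz
        else inclS (r (collapseZ hn p.1)) * Ls.wz * Ls.wb ^ ((p.2 : ℕ) - 1))
      fun j => (Ls.wf * Ls.wb) ^ (n - 1) * Ls.wz * Ls.wb ^ ((j : ℕ) - 1))

theorem sWord_mem_Ws (hn : 3 ≤ n) (W₀ : Set (FreeMonoid L0)) (r : PTzeta n → FreeMonoid L0)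
    (hr : ∀ m, r m ∈ W₀) (hr' : ∀ m, L0.eval n (r m) = m) (i : IndexS n) :
    sWord hn r i ∈ Ws n W₀ := by
  rcases i with (m | m) | (⟨A, k⟩ | j)
  · exact .inl (.inl (.inl (.inl ⟨r m, hr m, rfl⟩)))
  · exact .inl (.inl (.inl (.inr ⟨r m, hr m, rfl⟩)))
  · by_cases hk : k = 0
    · exact .inl (.inr ⟨A, A.2.1, A.2.2, _, hr (collapseZ hn A), hr' _, by simp [sWord, hk]⟩)
    · refine .inl (.inl (.inr ⟨A, A.2.1, A.2.2, _, hr (collapseZ hn A), hr' _, k, ?_, ?_, by simp [sWord, hk]⟩))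
      · rw [eq_zero_iff_val] at hk
        omega
      · omega
  · have hj := j.2
    rw [Ne, eq_zero_iff_val] at hj
    exact .inr ⟨j, by omega, by omega, rfl⟩

theorem mk_sWord (hn : 3 ≤ n) (hR₀ : Defines R₀ (PTzeta n) (L0.gen n))
    (r : PTzeta n → FreeMonoid L0) (hr : ∀ m, L0.eval n (r m) = m) (i : IndexS n) :
    PresentedMonoid.mk (Ls.Rel n R₀) (sWord hn r i) =
      nfS hn (baseS hR₀) (PresentedMonoid.mk (Ls.Rel n R₀) Ls.wd)
        (PresentedMonoid.mk (Ls.Rel n R₀) Ls.wz) i := by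
  have hι (m : PTzeta n) : PresentedMonoid.mk (Ls.Rel n R₀) (inclS (r m)) = baseS hR₀ m :=
    (baseS_eq hR₀ m _ (hr m)).symm
  rcases i with (m | m) | (⟨A, k⟩ | j)
  · exact hι m
  · simp [sWord, nfS, hι]
  · simp only [sWord, nfS, Sum.elim_inr, Sum.elim_inl, baseS_cycleZ_pow]
    split_ifs <;> simp only [map_mul, hι]
  · simp only [sWord, nfS, Sum.elim_inr, baseS_cycleZ_pow,
      baseS_eq hR₀ (collapseZ hn ∅) _ (eval_eq_pow_fb hn), map_mul, map_pow]
    rfl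

theorem Ws_subset_range_sWord (hn : 3 ≤ n) (W₀ : Set (FreeMonoid L0))
    (r : PTzeta n → FreeMonoid L0) (hr : ∀ u ∈ W₀, ∃ m, r m = u)
    (hr' : ∀ m, L0.eval n (r m) = m) : Ws n W₀ ⊆ Set.range (sWord hn r) := by
  have hcol (A : Finset (Fin n)) (u : FreeMonoid L0) (hu : u ∈ W₀)
      (h : L0.eval n u = collapse n A) : r (collapseZ hn A) = u := by
    obtain ⟨m, rfl⟩ := hr u hu
    rw [hr'] at h
    exact congrArg r (Subtype.ext h.symm)
  rintro _ ((((⟨u, hu, rfl⟩ | ⟨u, hu, rfl⟩) | ⟨A, hA, h0, u, hu, hev, j, hj, hj', rfl⟩) |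
    ⟨A, hA, h0, u, hu, hev, rfl⟩) | ⟨j, hj, hj', rfl⟩)
  · obtain ⟨m, rfl⟩ := hr u hu
    exact ⟨.inl (.inl m), rfl⟩
  · obtain ⟨m, rfl⟩ := hr u hu
    exact ⟨.inl (.inr m), rfl⟩
  · have hj0 : (⟨j, by omega⟩ : Fin n) ≠ 0 := by rw [Ne, eq_zero_iff_val]; simp only; omega
    exact ⟨.inr (.inl (⟨A, hA, h0⟩, ⟨j, by omega⟩)), by simp [sWord, hj0, hcol A u hu hev]⟩
  · exact ⟨.inr (.inl (⟨A, hA, h0⟩, 0)), by simp [sWord, hcol A u hu hev]⟩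
  · have hj0 : (⟨j, by omega⟩ : Fin n) ≠ 0 := by rw [Ne, eq_zero_iff_val]; simp only; omega
    exact ⟨.inr (.inr ⟨⟨j, by omega⟩, hj0⟩), rfl⟩

theorem isCanonicalForms_Ws (hn : 3 ≤ n) (hR₀ : Defines R₀ (PTzeta n) (L0.gen n))
    (W₀ : Set (FreeMonoid L0)) (hW₀ : IsCanonicalForms R₀ (PTzeta n) W₀) :
    IsCanonicalForms (Ls.Rel n R₀) (PsEnd (starGraph n)) (Ws n W₀) := by
  have hex (m : PTzeta n) : ∃ u ∈ W₀, L0.eval n u = m := by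
    obtain ⟨φ, hφ⟩ := id hR₀
    obtain ⟨u, hu, h⟩ := hW₀.1 (wordOf hR₀ m)
    refine ⟨u, hu, ?_⟩
    rw [← eval_wordOf hR₀ m, ← coe_iso_mk hφ, ← coe_iso_mk hφ, PresentedMonoid.mk_eq_mk_iff.2 h]
  choose r hr hr' using hex
  -- By its size `W₀` has only one word for each element, so it contains no words beyond the chosen
  -- representatives. The upper bound on the size of `Ws n W₀` needs this.
  have hsurj (u : FreeMonoid L0) (hu : u ∈ W₀) : ∃ m, r m = u := by
    obtain ⟨φ, hφ⟩ := id hR₀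
    refine ⟨φ (PresentedMonoid.mk R₀ u), hW₀.injOn_mk hR₀ (hr _) hu ?_⟩
    rw [PresentedMonoid.mk_eq_mk_iff]
    exact conGen_of_eval_eq hR₀ (by rw [hr', coe_iso_mk hφ])
  constructor
  · intro w
    obtain ⟨i, hi⟩ := nfS_surjective hn hR₀ (PresentedMonoid.mk _ w)
    refine ⟨sWord hn r i, sWord_mem_Ws hn W₀ r hr hr' i, ?_⟩
    rw [← PresentedMonoid.mk_eq_mk_iff, mk_sWord hn hR₀ r hr', hi]
  · refine (Set.encard_le_encard (Ws_subset_range_sWord hn W₀ r hsurj hr')).trans ?_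
    rw [encard_PsEnd hn, ← Set.image_univ, ← ENat.card_eq_coe_natCard, ← Set.encard_univ]
    exact Set.encard_image_le _ _

end CanonicalForms

end StarGraphMonoid

open StarGraphMonoid in
theorem theorem4p3 (n : ℕ) [NeZero n] (hn : 3 ≤ n)
    (R₀ : FreeMonoid L0 → FreeMonoid L0 → Prop)
    (hR₀ : Defines R₀ (PTzeta n) (L0.gen n)) :
    Defines (Lsw.Rel n R₀) (PswEnd (starGraph n)) (Lsw.gen n) ∧
    (Nat.card (PswEnd (starGraph n)) : ℤ) = 2 * (n : ℤ) ^ (n - 1) + n * 2 ^ n - n - 1 ∧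
    (∀ ω : Finset (Fin n) → FreeMonoid L0, IsIdWords n ω →
      (∀ W₀ : Set (FreeMonoid L0), IsBaseForms n R₀ W₀ →
        IsCanonicalForms (Lsw.Rel n R₀) (PswEnd (starGraph n)) (Wsw n (Ws n W₀) ω) ∧
        ((Wsw n (Ws n W₀) ω).ncard : ℤ) = 2 * (n : ℤ) ^ (n - 1) + n * 2 ^ n - n - 1) ∧
      (∀ V : Set (FreeMonoid Ls), 1 ∈ V →
        IsCanonicalForms (Ls.Rel n R₀) (PsEnd (starGraph n)) V →
        IsCanonicalForms (Lsw.Rel n R₀) (PswEnd (starGraph n)) (Wsw n V ω) ∧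
        ((Wsw n V ω).ncard : ℤ) = 2 * (n : ℤ) ^ (n - 1) + n * 2 ^ n - n - 1)) := by
  have hdef := defines_PswEnd hn hR₀
  -- Coincidences between the listed words never have to be examined: a set of canonical forms has
  -- exactly as many elements as the monoid.
  have hncard : ∀ W : Set (FreeMonoid Lsw),
      IsCanonicalForms (Lsw.Rel n R₀) (PswEnd (starGraph n)) W →
      (W.ncard : ℤ) = 2 * (n : ℤ) ^ (n - 1) + n * 2 ^ n - n - 1 := by
    intro W hW
    rw [← card_indexSw, Set.ncard_def, hW.encard_eq hdef, encard_PswEnd hn, ENat.toNat_natCast]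
  refine ⟨hdef, ?_, fun ω hω => ⟨fun W₀ hW₀ => ?_, fun V _ hV => ?_⟩⟩
  · have h : Nat.card (PswEnd (starGraph n)) = Nat.card (IndexSw n) := by
      have h := encard_PswEnd hn
      rw [← ENat.toNat_natCast (Nat.card (IndexSw n)), ← h]
      rfl
    rw [h, card_indexSw]
  · have h := isCanonicalForms_Wsw hn hR₀ ω hω _ (isCanonicalForms_Ws hn hR₀ W₀ hW₀.1)
    exact ⟨h, hncard _ h⟩
  · have h := isCanonicalForms_Wsw hn hR₀ ω hω V hV
    exact ⟨h, hncard _ h⟩
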